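/- Let $k$ be an algebraically closed field of characteristic zero and $\mathcal C$ a fusion category over $k$ (for example, a modular fusion category), and let $A,A',A''$ be Frobenius algebras in $\mathcal C$ with $\mu\circ\Delta=\mathrm{id}$ (for example, simple special symmetric Frobenius algebras). Let $\mathrm{mod}\text{-}A$ be the category of right $A$-modules, a left module category over $\mathcal C$ via $c\odot M=c\otimes M$. For module categories $\mathcal M,\mathcal N$ over $\mathcal C$ write $\underline{\mathrm{Hom}}(m,m')\in\mathcal C$ for the internal Hom, i.e. the object representing $c\mapsto \mathrm{Hom}(c\odot m,m')$; write $\underline{\mu}:\underline{\mathrm{Hom}}(m',m'')\otimes\underline{\mathrm{Hom}}(m,m')\to\underline{\mathrm{Hom}}(m,m'')$ for the composition of internal Homs and, for a module functor $G$, $\underline{G}:\underline{\mathrm{Hom}}(m,m')\to\underline{\mathrm{Hom}}(Gm,Gm')$ for the induced morphism. For $\mathcal C$-module functors $F,F':\mathcal M\to\mathcal N$ let $\underline{\mathrm{Nat}}(F,F')=\int_{m}\underline{\mathrm{Hom}}(Fm,F'm)$ with dinatural structure morphisms $j_m$. It is regarded as an object of the Drinfeld center $\mathcal Z(\mathcal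 C)$ with the half-braiding $c_{\underline{\mathrm{Nat}}(F,F');-}$ for which the morphisms $\mathrm{ev}\circ(j_m\odot\mathrm{id}):\underline{\mathrm{Nat}}(F,F')\odot Fm\to F'm$ form a module natural transformation. For an $A$-$B$-bimodule $X$ let $G^X=-\otimes_A X:\mathrm{mod}\text{-}A\to\mathrm{mod}\text{-}B$, a $\mathcal C$-module functor, and for $A$-$B$-bimodules $X,Y$ let $$\mathbb D^{X,Y}=\underline{\mathrm{Nat}}(G^X,G^Y)\in\mathcal Z(\mathcal C)$$ be the object of defect fields. Let $X_1,X_3$ be $A$-$A'$-bimodules and $X_2,X_4$ be $A'$-$A''$-bimodules, and put $G_i=G^{X_i}$. Using the canonical isomorphisms of module functors $G_2\circ G_1\cong G^{X_1\otimes_{A'}X_2}$ and $G_4\circ G_3\cong G^{X_3\otimes_{A'}X_4}$, identify $\underline{\mathrm{Nat}}(G_2G_1,G_4G_3)$ with $\mathbb D^{X_1\otimes_{A'}X_2,\,X_3\otimes_{A'}X_4}$. The left and right horizontal operator products $$\mu_{\rm hor}^{\rm left}:\mathbb D^{X_2,X_4}\otimes\mathbb D^{X_1,X_3}\to\mathbb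 D^{X_1\otimes_{A'}X_2,X_3\otimes_{A'}X_4},\qquad \mu_{\rm hor}^{\rm right}:\mathbb D^{X_1,X_3}\otimes\mathbb D^{X_2,X_4}\to\mathbb D^{X_1\otimes_{A'}X_2,X_3\otimes_{A'}X_4}$$ are the morphisms in $\mathcal Z(\mathcal C)$ induced, through the universal property of the end, by the dinatural families (for $M\in\mathrm{mod}\text{-}A$) $$\underline{\mu}\circ(\mathrm{id}\otimes\underline{G_2})\circ(j^{G_2,G_4}_{G_3M}\otimes j^{G_1,G_3}_M)\qquad\text{and}\qquad \underline{\mu}\circ(\underline{G_4}\otimes\mathrm{id})\circ(j^{G_1,G_3}_M\otimes j^{G_2,G_4}_{G_1M}),$$ respectively. Then the two products differ by a half-braiding: $$\mu_{\rm hor}^{\rm left}=\mu_{\rm hor}^{\rm right}\circ c_{\mathbb D^{X_2,X_4};\,\mathbb D^{X_1,X_3}}\, ,$$ where $c_{\mathbb D^{X_2,X_4};\,\mathbb D^{X_1,X_3}}:\mathbb D^{X_2,X_4}\otimes\mathbb D^{X_1,X_3}\to\mathbb D^{X_1,X_3}\otimes\mathbb D^{X_2,X_4}$ is the half-braiding of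 $\mathbb D^{X_2,X_4}$. -/

import Mathlib

open CategoryTheory MonoidalCategory Limits

namespace DefectFields

universe v u v₁ u₁ v₂ u₂ v₃ u₃ w

section InternalHoms

open scoped MonoidalLeftAction

variable {C : Type u} [Category.{v} C] [MonoidalCategory C]
variable {M : Type u₁} [Category.{v₁} M] [MonoidalLeftAction C M]

variable (C) in
/-- An internal Hom of two objects of a module category `M` over `C`: an object of `C` that
represents the functor `c ↦ (c ⊙ₗ m ⟶ m')`, with universal element `ev`. -/
structure InternalHom (m m' : M) where
  obj : C
  ev : obj ⊙ₗ m ⟶ m'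
  exists_unique : ∀ (c : C) (f : c ⊙ₗ m ⟶ m'), ∃! g : c ⟶ obj, g ⊵ₗ m ≫ ev = f

variable (C M) in
/-- All internal Homs of the module category `M` exist. -/
class HasInternalHoms : Prop where
  nonempty : ∀ m m' : M, Nonempty (InternalHom C m m')

variable [HasInternalHoms C M]

variable (C) in
/-- The internal Hom `iHom(m, m')` in `C`. -/
noncomputable def iHom (m m' : M) : C :=
  (Classical.choice (HasInternalHoms.nonempty (C := C) m m')).obj

variable (C) in
/-- The evaluation `iHom(m, m') ⊙ m ⟶ m'`. -/
noncomputable def iEv (m m' : M) : iHom C m m' ⊙ₗ m ⟶ m' :=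
  (Classical.choice (HasInternalHoms.nonempty (C := C) m m')).ev

theorem iHom_exists_unique {m m' : M} {c : C} (f : c ⊙ₗ m ⟶ m') :
    ∃! g : c ⟶ iHom C m m', g ⊵ₗ m ≫ iEv C m m' = f :=
  (Classical.choice (HasInternalHoms.nonempty (C := C) m m')).exists_unique c f

/-- The morphism `c ⟶ iHom(m, m')` that corresponds to `f : c ⊙ m ⟶ m'`. -/
noncomputable def iCurry {m m' : M} {c : C} (f : c ⊙ₗ m ⟶ m') : c ⟶ iHom C m m' :=
  (iHom_exists_unique f).choose

@[simp]
theorem iCurry_ev {m m' : M} {c : C} (f : c ⊙ₗ m ⟶ m') :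
    iCurry f ⊵ₗ m ≫ iEv C m m' = f :=
  (iHom_exists_unique f).choose_spec.1

@[simp]
theorem iCurry_ev_assoc {c : C} {m m' : M} (f : c ⊙ₗ m ⟶ m') {Z : M} (h : m' ⟶ Z) :
    iCurry (C := C) f ⊵ₗ m ≫ iEv C m m' ≫ h = f ≫ h := by
  rw [← Category.assoc, iCurry_ev]

theorem iHom_ext {m m' : M} {c : C} {g g' : c ⟶ iHom C m m'}
    (h : g ⊵ₗ m ≫ iEv C m m' = g' ⊵ₗ m ≫ iEv C m m') : g = g' :=
  (iHom_exists_unique (g' ⊵ₗ m ≫ iEv C m m')).unique h rfl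

variable (C) in
/-- Covariant functoriality of `iHom` in its second argument. -/
noncomputable def iHomPost (m : M) {n n' : M} (f : n ⟶ n') : iHom C m n ⟶ iHom C m n' :=
  iCurry (iEv C m n ≫ f)

variable (C) in
/-- Contravariant functoriality of `iHom` in its first argument. -/
noncomputable def iHomPre {m m' : M} (f : m ⟶ m') (n : M) : iHom C m' n ⟶ iHom C m n :=
  iCurry (iHom C m' n ⊴ₗ f ≫ iEv C m' n)

variable (C) in
/-- The multiplication `iHom(m', m'') ⊗ iHom(m, m') ⟶ iHom(m, m'')` of internal Homs. -/
noncomputable def iMul (m m' m'' : M) :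
    iHom C m' m'' ⊗ iHom C m m' ⟶ iHom C m m'' :=
  iCurry ((MonoidalLeftAction.actionAssocIso _ _ m).hom ≫
    iHom C m' m'' ⊴ₗ iEv C m m' ≫ iEv C m' m'')

variable {N : Type u₂} [Category.{v₂} N] [MonoidalLeftAction C N] [HasInternalHoms C N]

variable (C) in
/-- The morphism `iHom(m, m') ⟶ iHom(G m, G m')` induced by a module functor `G`. -/
noncomputable def iFun (G : M ⥤ N) [G.LeftLinear C] (m m' : M) :
    iHom C m m' ⟶ iHom C (G.obj m) (G.obj m') :=
  iCurry (Functor.LaxLeftLinear.μₗ G _ m ≫ G.map (iEv C m m'))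

theorem iHomPost_ev (m : M) {n n' : M} (f : n ⟶ n') :
    iHomPost C m f ⊵ₗ m ≫ iEv C m n' = iEv C m n ≫ f := iCurry_ev _

theorem iHomPre_ev {m m' : M} (f : m ⟶ m') (n : M) :
    iHomPre C f n ⊵ₗ m ≫ iEv C m n = iHom C m' n ⊴ₗ f ≫ iEv C m' n := iCurry_ev _

theorem iMul_ev (m m' m'' : M) :
    iMul C m m' m'' ⊵ₗ m ≫ iEv C m m'' = (MonoidalLeftAction.actionAssocIso _ _ m).hom ≫
      iHom C m' m'' ⊴ₗ iEv C m m' ≫ iEv C m' m'' := iCurry_ev _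

theorem iFun_ev (G : M ⥤ N) [G.LeftLinear C] (m m' : M) :
    iFun C G m m' ⊵ₗ G.obj m ≫ iEv C _ _ =
      Functor.LaxLeftLinear.μₗ G _ m ≫ G.map (iEv C m m') := iCurry_ev _

end InternalHoms

section InternalNats

open scoped MonoidalLeftAction
open Functor.LaxLeftLinear Functor.OplaxLeftLinear MonoidalLeftAction

variable {C : Type u} [Category.{v} C] [MonoidalCategory C]
variable {M : Type u₁} [Category.{v₁} M] [MonoidalLeftAction C M]
variable {N : Type u₂} [Category.{v₂} N] [MonoidalLeftAction C N]
variable {L : Type u₃} [Category.{v₃} L] [MonoidalLeftAction C L]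

/-- Naturality in `m` of a family `c ⊙ F m ⟶ F' m`. -/
def IsNatFam (c : C) (F F' : M ⥤ N) (φ : ∀ m, c ⊙ₗ F.obj m ⟶ F'.obj m) : Prop :=
  ∀ ⦃m m' : M⦄ (f : m ⟶ m'), c ⊴ₗ F.map f ≫ φ m' = φ m ≫ F'.map f

/-- A family `Z ⊙ F m ⟶ F' m`, for `Z` in the Drinfeld center, respects the module structures,
where `Z ⊙ F` is a module functor through the half-braiding of `Z`. -/
def IsModFam (Z : Center C) (F F' : M ⥤ N) [F.LeftLinear C] [F'.LeftLinear C]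
    (φ : ∀ m, Z.1 ⊙ₗ F.obj m ⟶ F'.obj m) : Prop :=
  ∀ (c : C) (m : M), Z.1 ⊴ₗ μₗ F c m ≫ φ (c ⊙ₗ m) =
    (αₗ Z.1 c (F.obj m)).inv ≫ (Z.2.β c).hom ⊵ₗ F.obj m ≫ (αₗ c Z.1 (F.obj m)).hom ≫
      c ⊴ₗ φ m ≫ μₗ F' c m

variable [HasInternalHoms C N]

/-- Dinaturality of a family of morphisms `c ⟶ iHom(F m, F' m)`. -/
def IsDinat (c : C) (F F' : M ⥤ N) (φ : ∀ m, c ⟶ iHom C (F.obj m) (F'.obj m)) : Prop :=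
  ∀ ⦃m m' : M⦄ (f : m ⟶ m'),
    φ m ≫ iHomPost C (F.obj m) (F'.map f) = φ m' ≫ iHomPre C (F.map f) (F'.obj m')

theorem isDinat_iff {c : C} {F F' : M ⥤ N} (φ : ∀ m, c ⟶ iHom C (F.obj m) (F'.obj m)) :
    IsDinat c F F' φ ↔ IsNatFam c F F' (fun m => φ m ⊵ₗ F.obj m ≫ iEv C _ _) := by
  refine forall_congr' fun m => forall_congr' fun m' => forall_congr' fun f => ?_
  constructor
  · intro h
    have := congrArg (fun t => t ⊵ₗ F.obj m ≫ iEv C _ _) h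
    simp only [iHomPost, iHomPre, comp_actionHomLeft, Category.assoc, iCurry_ev] at this
    simp only [Category.assoc]
    rw [this, action_exchange_assoc]
  · intro h
    apply iHom_ext
    simp only [iHomPost, iHomPre, comp_actionHomLeft, Category.assoc, iCurry_ev]
    rw [← action_exchange_assoc]
    simpa using h.symm

variable (C) in
/-- An object of internal natural transformations from `F` to `F'`: an end
`∫ m, iHom(F m, F' m)` in `C`, lifted to the Drinfeld center by the half-braiding for which the
evaluations form a module natural transformation. -/
structure InternalNat (F F' : M ⥤ N) [F.LeftLinear C] [F'.LeftLinear C] where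
  obj : Center C
  j : ∀ m, obj.1 ⟶ iHom C (F.obj m) (F'.obj m)
  dinat : IsDinat obj.1 F F' j
  exists_unique : ∀ (c : C) (φ : ∀ m, c ⟶ iHom C (F.obj m) (F'.obj m)), IsDinat c F F' φ →
    ∃! g : c ⟶ obj.1, ∀ m, g ≫ j m = φ m
  isMod : IsModFam obj F F' (fun m => j m ⊵ₗ F.obj m ≫ iEv C _ _)

end InternalNats

section Representing
open scoped MonoidalLeftAction
open Functor.LaxLeftLinear Functor.OplaxLeftLinear MonoidalLeftAction

variable {C : Type u} [Category.{v} C] [MonoidalCategory C]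
variable {M : Type u₁} [Category.{v₁} M] [MonoidalLeftAction C M]
variable {N : Type u₂} [Category.{v₂} N] [MonoidalLeftAction C N]

theorem act_snake₁ (c c' : C) [ExactPairing c c'] (m : M) :
    (λₗ (c ⊙ₗ m : M)).inv ≫ η_ c c' ⊵ₗ (c ⊙ₗ m) ≫ (αₗ c c' (c ⊙ₗ m)).hom ≫
      c ⊴ₗ ((αₗ c' c m).inv ≫ ε_ c c' ⊵ₗ m ≫ (λₗ m).hom) = 𝟙 _ := by
  have h := congrArg (fun t => ((λ_ c).inv ≫ t ≫ (ρ_ c).hom) ⊵ₗ m)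
    (ExactPairing.evaluation_coevaluation c c')
  simp only [comp_actionHomLeft, whiskerLeft_actionHomLeft, whiskerRight_actionHomLeft,
    rightUnitor_actionHom, leftUnitor_actionHom, Category.assoc, Iso.inv_hom_id_assoc,
    Iso.inv_hom_id, Category.comp_id, id_actionHomLeft] at h
  rw [← h]
  have h2 := associator_actionHom c c' c m
  have h3 : (λ_ c).inv ⊵ₗ m = (λₗ (c ⊙ₗ m : M)).inv ≫ (αₗ (𝟙_ C) c m).inv := by
    rw [← cancel_mono ((αₗ (𝟙_ C) c m).hom ≫ (λₗ (c ⊙ₗ m : M)).hom), ← leftUnitor_actionHom,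
      ← comp_actionHomLeft]
    simp
  rw [h3]
  have h4 : (αₗ (c ⊗ c') c m).inv ≫ (α_ c c' c).hom ⊵ₗ m ≫ (αₗ c (c' ⊗ c) m).hom =
      (αₗ c c' (c ⊙ₗ m)).hom ≫ c ⊴ₗ (αₗ c' c m).inv := by
    rw [Iso.inv_comp_eq, ← cancel_mono (c ⊴ₗ (αₗ c' c m).hom)]
    simp only [Category.assoc, h2]
    rw [← actionHomRight_comp]; simp
  simp only [Category.assoc, Iso.inv_hom_id_assoc, actionHomRight_comp, reassoc_of% h4]

theorem act_snake₂ (c c' : C) [ExactPairing c c'] (m : M) :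
    (c' ⊴ₗ ((λₗ m).inv ≫ η_ c c' ⊵ₗ m ≫ (αₗ c c' m).hom)) ≫ (αₗ c' c (c' ⊙ₗ m)).inv ≫
      ε_ c c' ⊵ₗ (c' ⊙ₗ m) ≫ (λₗ (c' ⊙ₗ m : M)).hom = 𝟙 _ := by
  have h := congrArg (fun t => ((ρ_ c').inv ≫ t ≫ (λ_ c').hom) ⊵ₗ m)
    (ExactPairing.coevaluation_evaluation c c')
  simp only [comp_actionHomLeft, whiskerLeft_actionHomLeft, whiskerRight_actionHomLeft,
    rightUnitor_actionHom, leftUnitor_actionHom, Category.assoc, Iso.inv_hom_id_assoc,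
    Iso.inv_hom_id, Category.comp_id, id_actionHomLeft] at h
  rw [← h]
  have h2 := associator_actionHom c' c c' m
  have h3 : (ρ_ c').inv ⊵ₗ m = c' ⊴ₗ (λₗ m).inv ≫ (αₗ c' (𝟙_ C) m).inv := by
    rw [← cancel_mono ((αₗ c' (𝟙_ C) m).hom ≫ c' ⊴ₗ (λₗ m : _ ≅ m).hom),
      ← rightUnitor_actionHom, ← comp_actionHomLeft]
    simp
  rw [h3]
  have h4 : (αₗ c' (c ⊗ c') m).inv ≫ (α_ c' c c').inv ⊵ₗ m ≫ (αₗ (c' ⊗ c) c' m).hom =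
      c' ⊴ₗ (αₗ c c' m).hom ≫ (αₗ c' c (c' ⊙ₗ m)).inv := by
    rw [Iso.inv_comp_eq, ← cancel_epi ((α_ c' c c').hom ⊵ₗ m), reassoc_of% h2,
      ← comp_actionHomLeft_assoc]
    simp
  simp only [Category.assoc, Iso.inv_hom_id_assoc, actionHomRight_comp, reassoc_of% h4]

variable {F F' : M ⥤ N} {E : C} {e : ∀ m, E ⊙ₗ F.obj m ⟶ F'.obj m}

theorem rep_left (huniv : ∀ (c : C) (φ : ∀ m, c ⊙ₗ F.obj m ⟶ F'.obj m), IsNatFam c F F' φ →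
    ∃! g : c ⟶ E, ∀ m, g ⊵ₗ F.obj m ≫ e m = φ m) (c c' d : C) [ExactPairing c c']
    (ψ : ∀ m, d ⊙ₗ F.obj m ⟶ c ⊙ₗ F'.obj m)
    (hψ : ∀ ⦃m m' : M⦄ (f : m ⟶ m'), d ⊴ₗ F.map f ≫ ψ m' = ψ m ≫ c ⊴ₗ F'.map f) :
    ∃ g : d ⟶ c ⊗ E, ∀ m, g ⊵ₗ F.obj m ≫ (αₗ c E (F.obj m)).hom ≫ c ⊴ₗ e m = ψ m := by
  obtain ⟨h, hh, -⟩ := huniv (c' ⊗ d) (fun m => (αₗ c' d _).hom ≫ c' ⊴ₗ ψ m ≫ (αₗ c' c _).inv ≫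
    ε_ c c' ⊵ₗ F'.obj m ≫ (λₗ (F'.obj m)).hom) (by
      intro m m' f
      simp only [tensor_actionHomRight, Category.assoc, Iso.inv_hom_id_assoc,
        Iso.cancel_iso_hom_left]
      rw [← actionHomRight_comp_assoc, hψ, actionHomRight_comp_assoc]
      rw [actionUnitIso_hom_naturality, ← action_exchange_assoc]
      simp)
  refine ⟨(λ_ d).inv ≫ η_ c c' ▷ d ≫ (α_ c c' d).hom ≫ c ◁ h, fun m => ?_⟩
  have h1 := hh m
  simp only [comp_actionHomLeft, whiskerLeft_actionHomLeft, Category.assoc, Iso.inv_hom_id_assoc]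
  rw [← actionHomRight_comp, h1]
  have h3 : (λ_ d).inv ⊵ₗ F.obj m = (λₗ (d ⊙ₗ F.obj m : N)).inv ≫ (αₗ (𝟙_ C) d _).inv := by
    rw [← cancel_mono ((αₗ (𝟙_ C) d _).hom ≫ (λₗ (d ⊙ₗ F.obj m : N)).hom), ← leftUnitor_actionHom,
      ← comp_actionHomLeft]
    simp
  have h5 := act_snake₁ c c' (F'.obj m)
  have h6 : (λₗ (d ⊙ₗ F.obj m)).inv ≫ η_ c c' ⊵ₗ (d ⊙ₗ F.obj m) ≫ (c ⊗ c') ⊴ₗ ψ m =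
      ψ m ≫ (λₗ _).inv ≫ η_ c c' ⊵ₗ _ := by
    rw [← action_exchange, actionUnitIso_inv_naturality_assoc]
  rw [h3]
  simp only [whiskerRight_actionHomLeft, actionHomRight_comp, Category.assoc,
    Iso.inv_hom_id_assoc, associator_actionHom_assoc] at h5 h6 ⊢
  have h7 := congrArg (fun t => t ≫ (αₗ c c' _).hom) h6
  simp only [tensor_actionHomRight, Category.assoc, Iso.inv_hom_id, Category.comp_id] at h7
  rw [reassoc_of% h7, h5, Category.comp_id]

theorem rep_left_ext (huniv : ∀ (c : C) (φ : ∀ m, c ⊙ₗ F.obj m ⟶ F'.obj m), IsNatFam c F F' φ →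
    ∃! g : c ⟶ E, ∀ m, g ⊵ₗ F.obj m ≫ e m = φ m) (hnat : IsNatFam E F F' e)
    (c c' d : C) [ExactPairing c c'] (g g' : d ⟶ c ⊗ E)
    (h : ∀ m, g ⊵ₗ F.obj m ≫ (αₗ c E (F.obj m)).hom ≫ c ⊴ₗ e m =
      g' ⊵ₗ F.obj m ≫ (αₗ c E (F.obj m)).hom ≫ c ⊴ₗ e m) : g = g' := by
  apply (tensorLeftHomEquiv d c c' E).symm.injective
  have key : ∀ g : d ⟶ c ⊗ E, ∀ m, ((tensorLeftHomEquiv d c c' E).symm g) ⊵ₗ F.obj m ≫ e m =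
      (αₗ c' d _).hom ≫ c' ⊴ₗ (g ⊵ₗ F.obj m ≫ (αₗ c E (F.obj m)).hom ≫ c ⊴ₗ e m) ≫
        (αₗ c' c _).inv ≫ ε_ c c' ⊵ₗ F'.obj m ≫ (λₗ (F'.obj m)).hom := by
    intro g m
    have h4 : (αₗ c' (c ⊗ E) (F.obj m)).inv ≫ (α_ c' c E).inv ⊵ₗ F.obj m ≫
        (αₗ (c' ⊗ c) E (F.obj m)).hom =
        c' ⊴ₗ (αₗ c E (F.obj m)).hom ≫ (αₗ c' c (E ⊙ₗ F.obj m)).inv := by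
      have h2 := associator_actionHom c' c E (F.obj m)
      rw [Iso.inv_comp_eq, ← cancel_epi ((α_ c' c E).hom ⊵ₗ F.obj m), reassoc_of% h2,
        ← comp_actionHomLeft_assoc]
      simp
    have h5 : ε_ c c' ⊵ₗ (E ⊙ₗ F.obj m) ≫ (λₗ (E ⊙ₗ F.obj m : N)).hom ≫ e m =
        (αₗ c' c _).hom ≫ c' ⊴ₗ c ⊴ₗ e m ≫ (αₗ c' c _).inv ≫ ε_ c c' ⊵ₗ F'.obj m ≫
          (λₗ (F'.obj m)).hom := by
      rw [actionUnitIso_hom_naturality, ← action_exchange_assoc]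
      simp
    simp only [tensorLeftHomEquiv, Equiv.coe_fn_symm_mk, comp_actionHomLeft,
      whiskerLeft_actionHomLeft, whiskerRight_actionHomLeft, leftUnitor_actionHom,
      Category.assoc, Iso.inv_hom_id_assoc, actionHomRight_comp, h5, reassoc_of% h4]
  exact (huniv _ (fun m => (tensorLeftHomEquiv d c c' E).symm g ⊵ₗ F.obj m ≫ e m) (fun m m' f => by
    rw [action_exchange_assoc, hnat f, Category.assoc])).unique (fun _ => rfl)
      (fun m => by rw [key, key, h])

end Representing

section HB2
open scoped MonoidalLeftAction
open Functor.LaxLeftLinear Functor.OplaxLeftLinear MonoidalLeftAction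

variable {C : Type u} [Category.{v} C] [MonoidalCategory C]
variable {M : Type u₁} [Category.{v₁} M] [MonoidalLeftAction C M]
variable {N : Type u₂} [Category.{v₂} N] [MonoidalLeftAction C N]
variable {F F' : M ⥤ N} [F.LeftLinear C] {E : C} {e : ∀ m, E ⊙ₗ F.obj m ⟶ F'.obj m}

theorem rep_right (huniv : ∀ (c : C) (φ : ∀ m, c ⊙ₗ F.obj m ⟶ F'.obj m), IsNatFam c F F' φ →
    ∃! g : c ⟶ E, ∀ m, g ⊵ₗ F.obj m ≫ e m = φ m) (c' c d : C) [ExactPairing c' c]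
    (ψ : ∀ m, d ⊙ₗ F.obj m ⟶ F'.obj (c ⊙ₗ m))
    (hψ : ∀ ⦃m m' : M⦄ (f : m ⟶ m'), d ⊴ₗ F.map f ≫ ψ m' = ψ m ≫ F'.map (c ⊴ₗ f)) :
    ∃ g : d ⟶ E ⊗ c, ∀ m, g ⊵ₗ F.obj m ≫ (αₗ E c (F.obj m)).hom ≫ E ⊴ₗ μₗ F c m ≫
      e (c ⊙ₗ m) = ψ m := by
  obtain ⟨h, hh, -⟩ := huniv (d ⊗ c') (fun m => (αₗ d c' _).hom ≫ d ⊴ₗ μₗ F c' m ≫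
    ψ (c' ⊙ₗ m) ≫ F'.map ((αₗ c c' m).inv ≫ ε_ c' c ⊵ₗ m ≫ (λₗ m).hom)) (by
      intro m m' f
      simp only [tensor_actionHomRight, Category.assoc, Iso.inv_hom_id_assoc,
        Iso.cancel_iso_hom_left]
      rw [← actionHomRight_comp_assoc, μₗ_naturality_right, actionHomRight_comp_assoc,
        reassoc_of% hψ (c' ⊴ₗ f), ← F'.map_comp, ← F'.map_comp]
      simp only [Category.assoc]
      rw [actionUnitIso_hom_naturality, ← action_exchange_assoc]
      simp)
  refine ⟨(ρ_ d).inv ≫ d ◁ η_ c' c ≫ (α_ d c' c).inv ≫ h ▷ c, fun m => ?_⟩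
  have h1 := hh (c ⊙ₗ m)
  have h3 : (ρ_ d).inv ⊵ₗ F.obj m = d ⊴ₗ (λₗ (F.obj m)).inv ≫ (αₗ d (𝟙_ C) _).inv := by
    rw [← cancel_mono ((αₗ d (𝟙_ C) (F.obj m)).hom ≫ d ⊴ₗ (λₗ (F.obj m) : _ ≅ F.obj m).hom),
      ← rightUnitor_actionHom, ← comp_actionHomLeft]
    simp [-μₗ_unitality, -δₗ_unitality_inv]
  have h4 : (αₗ d (c' ⊗ c) (F.obj m)).inv ≫ (α_ d c' c).inv ⊵ₗ F.obj m ≫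
        (αₗ (d ⊗ c') c (F.obj m)).hom =
        d ⊴ₗ (αₗ c' c (F.obj m)).hom ≫ (αₗ d c' (c ⊙ₗ F.obj m)).inv := by
    have h2 := associator_actionHom d c' c (F.obj m)
    rw [Iso.inv_comp_eq, ← cancel_epi ((α_ d c' c).hom ⊵ₗ F.obj m), reassoc_of% h2,
      ← comp_actionHomLeft_assoc]
    simp
  have h5 : h ⊵ₗ (c ⊙ₗ F.obj m) ≫ E ⊴ₗ μₗ F c m ≫ e (c ⊙ₗ m) =
      (αₗ d c' _).hom ≫ d ⊴ₗ c' ⊴ₗ μₗ F c m ≫ d ⊴ₗ μₗ F c' (c ⊙ₗ m) ≫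
    ψ (c' ⊙ₗ c ⊙ₗ m) ≫ F'.map ((αₗ c c' _).inv ≫ ε_ c' c ⊵ₗ (c ⊙ₗ m) ≫ (λₗ (c ⊙ₗ m)).hom) := by
    rw [← action_exchange_assoc, h1]
    simp
  have h6 : (λₗ (F.obj m)).inv ≫ η_ c' c ⊵ₗ F.obj m ≫ (αₗ c' c (F.obj m)).hom ≫
      c' ⊴ₗ μₗ F c m ≫ μₗ F c' (c ⊙ₗ m) =
      F.map ((λₗ m).inv ≫ η_ c' c ⊵ₗ m ≫ (αₗ c' c m).hom) := by
    rw [← μₗ_associativity, μₗ_naturality_left_assoc, Functor.map_comp, Functor.map_comp]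
    simp
  simp only [comp_actionHomLeft, whiskerLeft_actionHomLeft, whiskerRight_actionHomLeft,
    Category.assoc, Iso.inv_hom_id_assoc, h5, h3, reassoc_of% h4]
  have h7 := congrArg (fun t => d ⊴ₗ t) h6
  simp only [actionHomRight_comp] at h7
  rw [reassoc_of% h7, reassoc_of% hψ, ← F'.map_comp]
  rw [act_snake₂ c' c m]
  simp

theorem rep_right_ext (huniv : ∀ (c : C) (φ : ∀ m, c ⊙ₗ F.obj m ⟶ F'.obj m),
    IsNatFam c F F' φ → ∃! g : c ⟶ E, ∀ m, g ⊵ₗ F.obj m ≫ e m = φ m) (hnat : IsNatFam E F F' e)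
    (c' c d : C) [ExactPairing c' c] (g g' : d ⟶ E ⊗ c)
    (h : ∀ m, g ⊵ₗ F.obj m ≫ (αₗ E c (F.obj m)).hom ≫ E ⊴ₗ μₗ F c m ≫ e (c ⊙ₗ m) =
      g' ⊵ₗ F.obj m ≫ (αₗ E c (F.obj m)).hom ≫ E ⊴ₗ μₗ F c m ≫ e (c ⊙ₗ m)) : g = g' := by
  apply (tensorRightHomEquiv d c' c E).symm.injective
  have key : ∀ g : d ⟶ E ⊗ c, ∀ m, ((tensorRightHomEquiv d c' c E).symm g) ⊵ₗ F.obj m ≫ e m =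
      (αₗ d c' _).hom ≫ d ⊴ₗ μₗ F c' m ≫ (g ⊵ₗ F.obj (c' ⊙ₗ m) ≫ (αₗ E c (F.obj _)).hom ≫
        E ⊴ₗ μₗ F c _ ≫ e (c ⊙ₗ c' ⊙ₗ m)) ≫
          F'.map ((αₗ c c' m).inv ≫ ε_ c' c ⊵ₗ m ≫ (λₗ m).hom) := by
    intro g m
    have h4 : (αₗ (E ⊗ c) c' (F.obj m)).inv ≫ (α_ E c c').hom ⊵ₗ F.obj m ≫
        (αₗ E (c ⊗ c') (F.obj m)).hom =
        (αₗ E c (c' ⊙ₗ F.obj m)).hom ≫ E ⊴ₗ (αₗ c c' (F.obj m)).inv := by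
      have h2 := associator_actionHom E c c' (F.obj m)
      rw [Iso.inv_comp_eq, ← cancel_mono (E ⊴ₗ (αₗ c c' (F.obj m)).hom)]
      simp only [Category.assoc, h2]
      rw [← actionHomRight_comp]; simp
    have h5 : (αₗ c c' (F.obj m)).inv ≫ ε_ c' c ⊵ₗ F.obj m ≫ (λₗ (F.obj m)).hom =
        c ⊴ₗ μₗ F c' m ≫ μₗ F c (c' ⊙ₗ m) ≫
          F.map ((αₗ c c' m).inv ≫ ε_ c' c ⊵ₗ m ≫ (λₗ m).hom) := by
      rw [Functor.map_comp, Functor.map_comp, μₗ_associativity_inv_assoc,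
        ← μₗ_naturality_left_assoc, ← μₗ_unitality]
    have h6 := hnat ((αₗ c c' m).inv ≫ ε_ c' c ⊵ₗ m ≫ (λₗ m).hom)
    have h7 := congrArg (fun t => E ⊴ₗ t) h5
    simp only [actionHomRight_comp] at h7
    simp only [Category.assoc]
    rw [← h6, action_exchange_assoc]
    simp only [tensorRightHomEquiv, Equiv.coe_fn_symm_mk, comp_actionHomLeft,
      whiskerLeft_actionHomLeft, whiskerRight_actionHomLeft, rightUnitor_actionHom,
      Category.assoc, Iso.inv_hom_id_assoc, reassoc_of% h4, reassoc_of% h7,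
      tensor_actionHomRight]
  exact (huniv _ (fun m => (tensorRightHomEquiv d c' c E).symm g ⊵ₗ F.obj m ≫ e m) (fun m m' f => by
    rw [action_exchange_assoc, hnat f, Category.assoc])).unique (fun _ => rfl)
      (fun m => by rw [key, key, h])

end HB2

section HalfBraiding
open scoped MonoidalLeftAction
open Functor Functor.LaxLeftLinear Functor.OplaxLeftLinear MonoidalLeftAction

variable {C : Type u} [Category.{v} C] [MonoidalCategory C]
variable {M : Type u₁} [Category.{v₁} M] [MonoidalLeftAction C M]
variable {N : Type u₂} [Category.{v₂} N] [MonoidalLeftAction C N]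
variable {F F' : M ⥤ N} [F.LeftLinear C] [F'.LeftLinear C]
  {E : C} {e : ∀ m, E ⊙ₗ F.obj m ⟶ F'.obj m}

theorem halfBraiding_of_rep [RigidCategory C] (huniv : ∀ (c : C) (φ : ∀ m, c ⊙ₗ F.obj m ⟶ F'.obj m), IsNatFam c F F' φ →
    ∃! g : c ⟶ E, ∀ m, g ⊵ₗ F.obj m ≫ e m = φ m) (hnat : IsNatFam E F F' e) :
    ∃ B : HalfBraiding E, IsModFam (⟨E, B⟩ : Center C) F F' e := by
  have hb : ∀ c : C, ∃ b : E ⊗ c ⟶ c ⊗ E, ∀ m, b ⊵ₗ F.obj m ≫ (αₗ c E (F.obj m)).hom ≫ c ⊴ₗ e m =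
      (αₗ E c (F.obj m)).hom ≫ E ⊴ₗ μₗ F c m ≫ e (c ⊙ₗ m) ≫ δₗ F' c m := by
    intro c
    refine rep_left huniv c cᘁ (E ⊗ c) _ fun m m' f => ?_
    have := hnat (c ⊴ₗ f)
    simp only [tensor_actionHomRight, Category.assoc, Iso.inv_hom_id_assoc]
    rw [← actionHomRight_comp_assoc, μₗ_naturality_right, actionHomRight_comp_assoc,
      reassoc_of% this, δₗ_naturality_right]
  have hg : ∀ c : C, ∃ b : c ⊗ E ⟶ E ⊗ c, ∀ m, b ⊵ₗ F.obj m ≫ (αₗ E c (F.obj m)).hom ≫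
      E ⊴ₗ μₗ F c m ≫ e (c ⊙ₗ m) = (αₗ c E (F.obj m)).hom ≫ c ⊴ₗ e m ≫ μₗ F' c m := by
    intro c
    refine rep_right huniv (ᘁc) c (c ⊗ E) _ fun m m' f => ?_
    have := hnat f
    simp only [tensor_actionHomRight, Category.assoc, Iso.inv_hom_id_assoc]
    rw [← actionHomRight_comp_assoc, this, actionHomRight_comp_assoc, μₗ_naturality_right]
  choose b hb using hb
  choose g hg using hg
  let β : ∀ c : C, E ⊗ c ≅ c ⊗ E := fun c =>
    { hom := b c
      inv := g c
      hom_inv_id := by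
        refine rep_right_ext huniv hnat (ᘁc) c _ _ _ fun m => ?_
        have h1 := hb c m
        rw [comp_actionHomLeft, Category.assoc, hg, reassoc_of% h1]
        simp
      inv_hom_id := by
        refine rep_left_ext huniv hnat c cᘁ _ _ _ fun m => ?_
        have h1 := hg c m
        rw [comp_actionHomLeft, Category.assoc, hb, reassoc_of% h1]
        simp }
  refine ⟨⟨β, fun c c' => ?_, fun {c c'} f => ?_⟩, fun c m => ?_⟩
  · refine rep_left_ext huniv hnat (c ⊗ c') (c ⊗ c')ᘁ _ _ _ fun m => ?_
    have hb' : ∀ (c : C) (m : M), E ⊴ₗ μₗ F c m ≫ e (c ⊙ₗ m) = (αₗ E c (F.obj m)).inv ≫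
        b c ⊵ₗ F.obj m ≫ (αₗ c E (F.obj m)).hom ≫ c ⊴ₗ e m ≫ μₗ F' c m := by
      intro c m
      have h1 := hb c m
      rw [reassoc_of% h1]; simp
    have hA : ∀ (x y z : C) (n : N), (α_ x y z).inv ⊵ₗ n ≫ (αₗ (x ⊗ y) z n).hom =
        (αₗ x (y ⊗ z) n).hom ≫ x ⊴ₗ (αₗ y z n).hom ≫ (αₗ x y (z ⊙ₗ n)).inv := by
      intro x y z n
      have h0 := associator_actionHom x y z n
      rw [← cancel_epi ((α_ x y z).hom ⊵ₗ n), reassoc_of% h0, ← comp_actionHomLeft_assoc]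
      simp
    have hA2 : ∀ (x y z : C) (n : N), (α_ x y z).hom ⊵ₗ n ≫ (αₗ x (y ⊗ z) n).hom =
        (αₗ (x ⊗ y) z n).hom ≫ (αₗ x y (z ⊙ₗ n)).hom ≫ x ⊴ₗ (αₗ y z n).inv := by
      intro x y z n
      rw [← cancel_mono (x ⊴ₗ (αₗ y z n).hom)]
      simp only [Category.assoc, associator_actionHom]
      rw [← actionHomRight_comp]; simp
    rw [← cancel_mono ((αₗ c c' _).hom ≫ c ⊴ₗ μₗ F' c' m ≫ μₗ F' c (c' ⊙ₗ m))]
    have hn := hnat (αₗ c c' m).hom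
    have h1 := hb (c ⊗ c') m
    have h2 := congrArg (fun t => c ⊴ₗ t) (hb' c' m)
    simp only [actionHomRight_comp] at h2
    have h3 : (αₗ E c (c' ⊙ₗ F.obj m)).inv ≫ b c ⊵ₗ (c' ⊙ₗ F.obj m) ≫
        (αₗ c E (c' ⊙ₗ F.obj m)).hom ≫ c ⊴ₗ E ⊴ₗ μₗ F c' m = E ⊴ₗ c ⊴ₗ μₗ F c' m ≫
        (αₗ E c (F.obj (c' ⊙ₗ m))).inv ≫ b c ⊵ₗ F.obj (c' ⊙ₗ m) ≫
          (αₗ c E (F.obj (c' ⊙ₗ m))).hom := by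
      have h4 := action_exchange (b c) (μₗ F c' m)
      simp only [tensor_actionHomRight, Category.assoc] at h4
      rw [← cancel_epi (αₗ E c (c' ⊙ₗ F.obj m)).hom, reassoc_of% h4]
      simp
    simp only [Category.assoc]
    rw [reassoc_of% h1, ← μₗ_associativity, LeftLinear.δₗ_comp_μₗ_assoc, ← hn,
      ← actionHomRight_comp_assoc, μₗ_associativity]
    simp only [β, comp_actionHomLeft, Category.assoc, whiskerLeft_actionHomLeft,
      whiskerRight_actionHomLeft, Iso.inv_hom_id_assoc, tensor_actionHomRight,
      actionHomRight_comp, hb', reassoc_of% hA, reassoc_of% hA2, μₗ_associativity]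
    rw [← reassoc_of% h2, reassoc_of% h3]
  · refine rep_left_ext huniv hnat c' c'ᘁ _ _ _ fun m => ?_
    have h1 := hnat (f ⊵ₗ m)
    simp only [β, comp_actionHomLeft, Category.assoc, hb, whiskerLeft_actionHomLeft,
      whiskerRight_actionHomLeft, Iso.inv_hom_id_assoc, action_exchange]
    have h2 := hb c m
    rw [← actionHomRight_comp_assoc, μₗ_naturality_left, actionHomRight_comp_assoc,
      reassoc_of% h1, δₗ_naturality_left, ← action_exchange, reassoc_of% h2]
  · have h1 := hb c m
    simp only [β]
    rw [reassoc_of% h1]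
    simp

theorem nonempty_internalNat [RigidCategory C] [HasInternalHoms C N] (hnat : IsNatFam E F F' e)
    (huniv : ∀ (c : C) (φ : ∀ m, c ⊙ₗ F.obj m ⟶ F'.obj m), IsNatFam c F F' φ →
      ∃! g : c ⟶ E, ∀ m, g ⊵ₗ F.obj m ≫ e m = φ m) : Nonempty (InternalNat C F F') := by
  obtain ⟨B, hB⟩ := halfBraiding_of_rep (C := C) (F := F) (F' := F') huniv hnat
  have he : (fun m => (iCurry (e m) : E ⟶ _) ⊵ₗ F.obj m ≫ iEv C (F.obj m) (F'.obj m)) = e :=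
    funext fun m => iCurry_ev (e m)
  refine ⟨⟨⟨E, B⟩, fun m => iCurry (e m), (isDinat_iff _).2 ?_, fun c φ hφ => ?_, ?_⟩⟩
  · rwa [he]
  · obtain ⟨g, hg, hu⟩ := huniv c _ ((isDinat_iff φ).1 hφ)
    refine ⟨g, fun m => iHom_ext ?_, fun g' hg' => hu g' fun m => ?_⟩
    · rw [comp_actionHomLeft, Category.assoc, iCurry_ev, hg]
    · rw [← hg', comp_actionHomLeft, Category.assoc, iCurry_ev]
  · have := hB
    rwa [← he] at this
end HalfBraiding

section HorizontalGeneral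
open scoped MonoidalLeftAction
open Functor Functor.LaxLeftLinear Functor.OplaxLeftLinear MonoidalLeftAction

variable {C : Type u} [Category.{v} C] [MonoidalCategory C]
variable {M : Type u₁} [Category.{v₁} M] [MonoidalLeftAction C M]
variable {N : Type u₂} [Category.{v₂} N] [MonoidalLeftAction C N]
variable {L : Type u₃} [Category.{v₃} L] [MonoidalLeftAction C L]

/-- The composite of module functors is a module functor. -/
instance compLeftLinear (F : M ⥤ N) (G : N ⥤ L) [F.LeftLinear C] [G.LeftLinear C] :
    (F ⋙ G).LeftLinear C where
  μₗ c m := μₗ G c (F.obj m) ≫ G.map (μₗ F c m)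
  δₗ c m := G.map (δₗ F c m) ≫ δₗ G c (F.obj m)
  μₗ_naturality_left f m := by
    simp only [Functor.comp_obj, Functor.comp_map, Category.assoc, ← G.map_comp]
    rw [μₗ_naturality_left_assoc, ← G.map_comp, μₗ_naturality_left]
  μₗ_naturality_right c m m' f := by
    simp only [Functor.comp_obj, Functor.comp_map, Category.assoc, ← G.map_comp]
    rw [μₗ_naturality_right_assoc, ← G.map_comp, μₗ_naturality_right]
  μₗ_associativity c c' m := by
    simp only [Functor.comp_obj, Functor.comp_map, Category.assoc, ← G.map_comp,
      μₗ_associativity, actionHomRight_comp]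
    rw [μₗ_naturality_right_assoc, G.map_comp, μₗ_associativity_assoc, ← G.map_comp]
  μₗ_unitality m := by
    simp only [Functor.comp_obj, Functor.comp_map, Category.assoc, ← G.map_comp]
    rw [← μₗ_unitality, ← μₗ_unitality]
  δₗ_naturality_left f m := by
    simp only [Functor.comp_obj, Functor.comp_map, Category.assoc]
    rw [← δₗ_naturality_left, ← G.map_comp_assoc, ← G.map_comp_assoc, δₗ_naturality_left]
  δₗ_naturality_right c m m' f := by
    simp only [Functor.comp_obj, Functor.comp_map, Category.assoc]
    rw [← δₗ_naturality_right, ← G.map_comp_assoc, ← G.map_comp_assoc, δₗ_naturality_right]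
  δₗ_associativity c c' m := by
    simp only [Functor.comp_obj, Functor.comp_map, Category.assoc, actionHomRight_comp]
    rw [← δₗ_naturality_right_assoc, δₗ_associativity]
    simp only [← G.map_comp_assoc, Category.assoc]
    rw [δₗ_associativity]
  δₗ_unitality_inv m := by
    simp only [Functor.comp_obj, Functor.comp_map]
    rw [← G.map_comp_assoc, ← δₗ_unitality_inv, ← δₗ_unitality_inv]
  μₗ_comp_δₗ c m := by
    change (μₗ G c (F.obj m) ≫ G.map (μₗ F c m)) ≫ G.map (δₗ F c m) ≫ δₗ G c (F.obj m) = _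
    rw [Category.assoc, ← G.map_comp_assoc]
    simp
  δₗ_comp_μₗ c m := by
    change (G.map (δₗ F c m) ≫ δₗ G c (F.obj m)) ≫ μₗ G c (F.obj m) ≫ G.map (μₗ F c m) = _
    rw [Category.assoc, LeftLinear.δₗ_comp_μₗ_assoc, ← G.map_comp]
    simp

theorem IsNatFam.map {c : C} {F F' : M ⥤ N} {φ : ∀ m, c ⊙ₗ F.obj m ⟶ F'.obj m}
    (h : IsNatFam c F F' φ) (G : N ⥤ L) [G.LeftLinear C] :
    IsNatFam c (F ⋙ G) (F' ⋙ G) (fun m => μₗ G c (F.obj m) ≫ G.map (φ m)) := by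
  intro m m' f
  simp only [Functor.comp_map, Category.assoc, ← G.map_comp]
  rw [μₗ_naturality_right_assoc, ← G.map_comp, h f]

theorem IsModFam.map {Z : Center C} {F F' : M ⥤ N} [F.LeftLinear C] [F'.LeftLinear C]
    {φ : ∀ m, Z.1 ⊙ₗ F.obj m ⟶ F'.obj m}
    (h : IsModFam Z F F' φ) (G : N ⥤ L) [G.LeftLinear C] :
    IsModFam Z (F ⋙ G) (F' ⋙ G) (fun m => μₗ G Z.1 (F.obj m) ≫ G.map (φ m)) := by
  intro c m
  change Z.1 ⊴ₗ (μₗ G c (F.obj m) ≫ G.map (μₗ F c m)) ≫ _ =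
    (αₗ Z.1 c (G.obj (F.obj m))).inv ≫ (Z.2.β c).hom ⊵ₗ G.obj (F.obj m) ≫
      (αₗ c Z.1 (G.obj (F.obj m))).hom ≫ _ ≫ (μₗ G c (F'.obj m) ≫ G.map (μₗ F' c m))
  have h1 := congrArg G.map (h c m)
  simp only [G.map_comp] at h1
  simp only [actionHomRight_comp, Category.assoc, Functor.comp_obj]
  rw [μₗ_naturality_right_assoc, h1, μₗ_associativity_inv_assoc, ← μₗ_naturality_left_assoc,
    μₗ_associativity_assoc, μₗ_naturality_right_assoc]

theorem IsNatFam.pre {c : C} {G G' : N ⥤ L} {φ : ∀ m, c ⊙ₗ G.obj m ⟶ G'.obj m}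
    (h : IsNatFam c G G' φ) (K : M ⥤ N) :
    IsNatFam c (K ⋙ G) (K ⋙ G') (fun m => φ (K.obj m)) :=
  fun _ _ f => h (K.map f)

theorem IsModFam.pre {Z : Center C} {G G' : N ⥤ L} [G.LeftLinear C] [G'.LeftLinear C]
    {φ : ∀ m, Z.1 ⊙ₗ G.obj m ⟶ G'.obj m} (hn : IsNatFam Z.1 G G' φ)
    (h : IsModFam Z G G' φ) (K : M ⥤ N) [K.LeftLinear C] :
    IsModFam Z (K ⋙ G) (K ⋙ G') (fun m => φ (K.obj m)) := by
  intro c m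
  change Z.1 ⊴ₗ (μₗ G c (K.obj m) ≫ G.map (μₗ K c m)) ≫ φ (K.obj (c ⊙ₗ m)) =
    (αₗ Z.1 c (G.obj (K.obj m))).inv ≫ (Z.2.β c).hom ⊵ₗ G.obj (K.obj m) ≫
      (αₗ c Z.1 (G.obj (K.obj m))).hom ≫ _ ≫ (μₗ G' c (K.obj m) ≫ G'.map (μₗ K c m))
  have h1 := h c (K.obj m)
  simp only [actionHomRight_comp, Category.assoc, hn (μₗ K c m), reassoc_of% h1]

theorem IsNatFam.comp {c d : C} {F F' F'' : M ⥤ N} {φ : ∀ m, c ⊙ₗ F'.obj m ⟶ F''.obj m}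
    {ψ : ∀ m, d ⊙ₗ F.obj m ⟶ F'.obj m}
    (hφ : IsNatFam c F' F'' φ) (hψ : IsNatFam d F F' ψ) :
    IsNatFam (c ⊗ d) F F'' (fun m => (αₗ c d (F.obj m)).hom ≫ c ⊴ₗ ψ m ≫ φ m) := by
  intro m m' f
  simp only [tensor_actionHomRight, Category.assoc, Iso.inv_hom_id_assoc]
  rw [← actionHomRight_comp_assoc, hψ f, actionHomRight_comp_assoc, hφ f]

theorem IsModFam.comp {W Z : Center C} {F F' F'' : M ⥤ N} [F.LeftLinear C] [F'.LeftLinear C]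
    [F''.LeftLinear C] {φ : ∀ m, W.1 ⊙ₗ F'.obj m ⟶ F''.obj m}
    {ψ : ∀ m, Z.1 ⊙ₗ F.obj m ⟶ F'.obj m}
    (hφ : IsModFam W F' F'' φ) (hψ : IsModFam Z F F' ψ) :
    IsModFam (W ⊗ Z) F F'' (fun m => (αₗ W.1 Z.1 (F.obj m)).hom ≫ W.1 ⊴ₗ ψ m ≫ φ m) := by
  intro c m
  change (W.1 ⊗ Z.1) ⊴ₗ μₗ F c m ≫ (αₗ W.1 Z.1 (F.obj (c ⊙ₗ m))).hom ≫ _ =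
    (αₗ (W.1 ⊗ Z.1) c (F.obj m)).inv ≫
    ((α_ W.1 Z.1 c).hom ≫ W.1 ◁ (Z.2.β c).hom ≫ (α_ W.1 c Z.1).inv ≫ (W.2.β c).hom ▷ Z.1 ≫
      (α_ c W.1 Z.1).hom) ⊵ₗ F.obj m ≫ (αₗ c (W.1 ⊗ Z.1) (F.obj m)).hom ≫ _
  have h1 := hφ c m
  have h2 := congrArg (fun t => W.1 ⊴ₗ t) (hψ c m)
  simp only [actionHomRight_comp] at h2
  have hA : ∀ (x y z : C) (n : N), (α_ x y z).inv ⊵ₗ n ≫ (αₗ (x ⊗ y) z n).hom =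
      (αₗ x (y ⊗ z) n).hom ≫ x ⊴ₗ (αₗ y z n).hom ≫ (αₗ x y (z ⊙ₗ n)).inv := by
    intro x y z n
    have h0 := associator_actionHom x y z n
    rw [← cancel_epi ((α_ x y z).hom ⊵ₗ n), reassoc_of% h0, ← comp_actionHomLeft_assoc]
    simp
  have hA2 : ∀ (x y z : C) (n : N), (α_ x y z).hom ⊵ₗ n ≫ (αₗ x (y ⊗ z) n).hom =
      (αₗ (x ⊗ y) z n).hom ≫ (αₗ x y (z ⊙ₗ n)).hom ≫ x ⊴ₗ (αₗ y z n).inv := by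
    intro x y z n
    rw [← cancel_mono (x ⊴ₗ (αₗ y z n).hom)]
    simp only [Category.assoc, associator_actionHom]
    rw [← actionHomRight_comp]; simp
  have h3 : (αₗ W.1 c (Z.1 ⊙ₗ F.obj m)).inv ≫ (W.2.β c).hom ⊵ₗ (Z.1 ⊙ₗ F.obj m) ≫
      (αₗ c W.1 (Z.1 ⊙ₗ F.obj m)).hom ≫ c ⊴ₗ W.1 ⊴ₗ ψ m = W.1 ⊴ₗ c ⊴ₗ ψ m ≫
      (αₗ W.1 c (F'.obj m)).inv ≫ (W.2.β c).hom ⊵ₗ F'.obj m ≫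
        (αₗ c W.1 (F'.obj m)).hom := by
    have h4 := action_exchange (W.2.β c).hom (ψ m)
    simp only [tensor_actionHomRight, Category.assoc] at h4
    rw [← cancel_epi (αₗ W.1 c (Z.1 ⊙ₗ F.obj m)).hom, reassoc_of% h4]
    simp
  simp only [comp_actionHomLeft, Category.assoc, whiskerLeft_actionHomLeft,
    whiskerRight_actionHomLeft, Iso.inv_hom_id_assoc, tensor_actionHomRight,
    actionHomRight_comp, h1, reassoc_of% h2, reassoc_of% hA, reassoc_of% hA2]
  rw [← reassoc_of% h3]
  simp [reassoc_of% hA2]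

end HorizontalGeneral

section HorizontalProducts
open scoped MonoidalLeftAction
open Functor Functor.LaxLeftLinear Functor.OplaxLeftLinear MonoidalLeftAction

variable {C : Type u} [Category.{v} C] [MonoidalCategory C]
variable {M : Type u₁} [Category.{v₁} M] [MonoidalLeftAction C M]
variable {N : Type u₂} [Category.{v₂} N] [MonoidalLeftAction C N]
variable {L : Type u₃} [Category.{v₃} L] [MonoidalLeftAction C L]

section Lift

variable [HasInternalHoms C N] {F F' : M ⥤ N} [F.LeftLinear C] [F'.LeftLinear C]

theorem InternalNat.ev_universal (I : InternalNat C F F') (c : C)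
    (φ : ∀ m, c ⊙ₗ F.obj m ⟶ F'.obj m) (hφ : IsNatFam c F F' φ) :
    ∃! g : c ⟶ I.obj.1, ∀ m, g ⊵ₗ F.obj m ≫ I.j m ⊵ₗ F.obj m ≫ iEv C _ _ = φ m := by
  have he : (fun m => (iCurry (φ m) : c ⟶ _) ⊵ₗ F.obj m ≫ iEv C (F.obj m) (F'.obj m)) = φ :=
    funext fun m => iCurry_ev (φ m)
  obtain ⟨g, hg, hu⟩ := I.exists_unique c (fun m => iCurry (φ m))
    ((isDinat_iff _).2 (by rwa [he]))
  refine ⟨g, fun m => ?_, fun g' hg' => hu g' fun m => iHom_ext ?_⟩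
  · rw [← comp_actionHomLeft_assoc, hg, iCurry_ev]
  · rw [comp_actionHomLeft, Category.assoc, hg', iCurry_ev]

/-- The morphism into an object of internal natural transformations that is induced by a dinatural
family whose evaluations form a module natural transformation; it is a morphism in the center. -/
noncomputable def InternalNat.lift [RigidCategory C] (I : InternalNat C F F') (Z : Center C)
    (φ : ∀ m, Z.1 ⟶ iHom C (F.obj m) (F'.obj m)) (hd : IsDinat Z.1 F F' φ)
    (hm : IsModFam Z F F' (fun m => φ m ⊵ₗ F.obj m ≫ iEv C _ _)) : Z ⟶ I.obj where
  f := (I.exists_unique Z.1 φ hd).choose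
  comm c := by
    have hf := (I.exists_unique Z.1 φ hd).choose_spec.1
    have hf' : ∀ m, (I.exists_unique Z.1 φ hd).choose ⊵ₗ F.obj m ≫
        I.j m ⊵ₗ F.obj m ≫ iEv C _ _ = φ m ⊵ₗ F.obj m ≫ iEv C _ _ := fun m => by
      rw [← comp_actionHomLeft_assoc, hf]
    refine rep_left_ext I.ev_universal ((isDinat_iff _).1 I.dinat) c cᘁ _ _ _ fun m => ?_
    have h1 := I.isMod c m
    have h2 := hm c m
    rw [← cancel_mono (μₗ F' c m), ← cancel_epi (αₗ Z.1 c (F.obj m)).inv]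
    have h3 : ∀ t : Z.1 ⟶ I.obj.1, (αₗ Z.1 c (F.obj m)).inv ≫ (t ▷ c) ⊵ₗ F.obj m =
        t ⊵ₗ (c ⊙ₗ F.obj m) ≫ (αₗ I.obj.1 c (F.obj m)).inv := by
      intro t; simp
    simp only [comp_actionHomLeft, Category.assoc, whiskerLeft_actionHomLeft,
      Iso.inv_hom_id_assoc] at h1 h2 ⊢
    rw [reassoc_of% h3, ← h1, ← action_exchange_assoc, hf', h2, ← actionHomRight_comp_assoc, hf']

end Lift

section Products

variable [HasInternalHoms C N] [HasInternalHoms C L]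
variable {G₁ G₃ : M ⥤ N} {G₂ G₄ : N ⥤ L} [G₁.LeftLinear C] [G₂.LeftLinear C]
  [G₃.LeftLinear C] [G₄.LeftLinear C]

/-- The family `(j ⊗ j) ; (id ⊗ iG₂) ; imu` that defines the left horizontal product. -/
noncomputable def horLeftFam (I₂₄ : InternalNat C G₂ G₄) (I₁₃ : InternalNat C G₁ G₃) (m : M) :
    I₂₄.obj.1 ⊗ I₁₃.obj.1 ⟶ iHom C ((G₁ ⋙ G₂).obj m) ((G₃ ⋙ G₄).obj m) :=
  (I₂₄.j (G₃.obj m) ⊗ₘ I₁₃.j m) ≫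
    iHom C (G₂.obj (G₃.obj m)) (G₄.obj (G₃.obj m)) ◁ iFun C G₂ (G₁.obj m) (G₃.obj m) ≫
    iMul C (G₂.obj (G₁.obj m)) (G₂.obj (G₃.obj m)) (G₄.obj (G₃.obj m))

/-- The family `(j ⊗ j) ; (iG₄ ⊗ id) ; imu` that defines the right horizontal product. -/
noncomputable def horRightFam (I₂₄ : InternalNat C G₂ G₄) (I₁₃ : InternalNat C G₁ G₃) (m : M) :
    I₁₃.obj.1 ⊗ I₂₄.obj.1 ⟶ iHom C ((G₁ ⋙ G₂).obj m) ((G₃ ⋙ G₄).obj m) :=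
  (I₁₃.j m ⊗ₘ I₂₄.j (G₁.obj m)) ≫
    iFun C G₄ (G₁.obj m) (G₃.obj m) ▷ iHom C (G₂.obj (G₁.obj m)) (G₄.obj (G₁.obj m)) ≫
    iMul C (G₂.obj (G₁.obj m)) (G₄.obj (G₁.obj m)) (G₄.obj (G₃.obj m))

variable (I₂₄ : InternalNat C G₂ G₄) (I₁₃ : InternalNat C G₁ G₃)

theorem horLeftFam_ev (m : M) :
    horLeftFam I₂₄ I₁₃ m ⊵ₗ G₂.obj (G₁.obj m) ≫ iEv C _ _ =
      (αₗ I₂₄.obj.1 I₁₃.obj.1 _).hom ≫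
        I₂₄.obj.1 ⊴ₗ (μₗ G₂ I₁₃.obj.1 (G₁.obj m) ≫
          G₂.map (I₁₃.j m ⊵ₗ G₁.obj m ≫ iEv C _ _)) ≫
        I₂₄.j (G₃.obj m) ⊵ₗ G₂.obj (G₃.obj m) ≫ iEv C _ _ := by
  simp only [horLeftFam, tensorHom_def', comp_actionHomLeft, Category.assoc,
    whiskerLeft_actionHomLeft, whiskerRight_actionHomLeft, Functor.comp_obj,
    Functor.map_comp, actionHomRight_comp]
  have h1 := congrArg (fun t => iHom C (G₂.obj (G₃.obj m)) (G₄.obj (G₃.obj m)) ⊴ₗ t)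
    (iFun_ev (C := C) G₂ (G₁.obj m) (G₃.obj m))
  simp only [actionHomRight_comp] at h1
  rw [iMul_ev]
  simp only [Iso.inv_hom_id_assoc, reassoc_of% h1]
  rw [← action_exchange_assoc, ← action_exchange_assoc, ← actionHomRight_comp_assoc,
    μₗ_naturality_left]
  simp

theorem horRightFam_ev (m : M) :
    horRightFam I₂₄ I₁₃ m ⊵ₗ G₂.obj (G₁.obj m) ≫ iEv C _ _ =
      (αₗ I₁₃.obj.1 I₂₄.obj.1 _).hom ≫
        I₁₃.obj.1 ⊴ₗ (I₂₄.j (G₁.obj m) ⊵ₗ G₂.obj (G₁.obj m) ≫ iEv C _ _) ≫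
        μₗ G₄ I₁₃.obj.1 (G₁.obj m) ≫
          G₄.map (I₁₃.j m ⊵ₗ G₁.obj m ≫ iEv C _ _) := by
  simp only [horRightFam, tensorHom_def', comp_actionHomLeft, Category.assoc,
    whiskerLeft_actionHomLeft, whiskerRight_actionHomLeft, Functor.comp_obj,
    Functor.map_comp, actionHomRight_comp]
  rw [iMul_ev]
  simp only [Iso.inv_hom_id_assoc]
  rw [← action_exchange_assoc, iFun_ev, ← action_exchange_assoc, μₗ_naturality_left_assoc]

theorem horLeftFam_dinat : IsDinat (I₂₄.obj ⊗ I₁₃.obj).1 (G₁ ⋙ G₂) (G₃ ⋙ G₄)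
    (horLeftFam I₂₄ I₁₃) := by
  refine (isDinat_iff _).2 ?_
  exact Eq.mpr (congrArg (IsNatFam (I₂₄.obj.1 ⊗ I₁₃.obj.1) (G₁ ⋙ G₂) (G₃ ⋙ G₄))
    (funext (horLeftFam_ev I₂₄ I₁₃))) (IsNatFam.comp (((isDinat_iff _).1 I₂₄.dinat).pre G₃)
    (((isDinat_iff _).1 I₁₃.dinat).map G₂))

theorem horLeftFam_isMod : IsModFam (I₂₄.obj ⊗ I₁₃.obj) (G₁ ⋙ G₂) (G₃ ⋙ G₄)
    (fun m => horLeftFam I₂₄ I₁₃ m ⊵ₗ (G₁ ⋙ G₂).obj m ≫ iEv C _ _) := by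
  exact Eq.mpr (congrArg (IsModFam (I₂₄.obj ⊗ I₁₃.obj) (G₁ ⋙ G₂) (G₃ ⋙ G₄))
    (funext (horLeftFam_ev I₂₄ I₁₃))) (IsModFam.comp (I₂₄.isMod.pre ((isDinat_iff _).1 I₂₄.dinat) G₃)
    (I₁₃.isMod.map G₂))

theorem horRightFam_dinat : IsDinat (I₁₃.obj ⊗ I₂₄.obj).1 (G₁ ⋙ G₂) (G₃ ⋙ G₄)
    (horRightFam I₂₄ I₁₃) := by
  refine (isDinat_iff _).2 ?_
  exact Eq.mpr (congrArg (IsNatFam (I₁₃.obj.1 ⊗ I₂₄.obj.1) (G₁ ⋙ G₂) (G₃ ⋙ G₄))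
    (funext (horRightFam_ev I₂₄ I₁₃))) (IsNatFam.comp (((isDinat_iff _).1 I₁₃.dinat).map G₄)
    (((isDinat_iff _).1 I₂₄.dinat).pre G₁))

theorem horRightFam_isMod : IsModFam (I₁₃.obj ⊗ I₂₄.obj) (G₁ ⋙ G₂) (G₃ ⋙ G₄)
    (fun m => horRightFam I₂₄ I₁₃ m ⊵ₗ (G₁ ⋙ G₂).obj m ≫ iEv C _ _) := by
  exact Eq.mpr (congrArg (IsModFam (I₁₃.obj ⊗ I₂₄.obj) (G₁ ⋙ G₂) (G₃ ⋙ G₄))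
    (funext (horRightFam_ev I₂₄ I₁₃))) (IsModFam.comp (I₁₃.isMod.map G₄)
    (I₂₄.isMod.pre ((isDinat_iff _).1 I₂₄.dinat) G₁))

variable [RigidCategory C] (I : InternalNat C (G₁ ⋙ G₂) (G₃ ⋙ G₄))

/-- The left horizontal product of internal natural transformations. -/
noncomputable def horLeft : I₂₄.obj ⊗ I₁₃.obj ⟶ I.obj :=
  I.lift _ (horLeftFam I₂₄ I₁₃) (horLeftFam_dinat I₂₄ I₁₃) (horLeftFam_isMod I₂₄ I₁₃)

/-- The right horizontal product of internal natural transformations. -/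
noncomputable def horRight : I₁₃.obj ⊗ I₂₄.obj ⟶ I.obj :=
  I.lift _ (horRightFam I₂₄ I₁₃) (horRightFam_dinat I₂₄ I₁₃) (horRightFam_isMod I₂₄ I₁₃)

end Products

section Transport

variable [HasInternalHoms C N] {F F' H H' : M ⥤ N} [F.LeftLinear C] [F'.LeftLinear C]
  [H.LeftLinear C] [H'.LeftLinear C]

variable (C) in
/-- A natural transformation of module functors that respects the module structures. -/
def IsModNat (a : F ⟶ H) : Prop :=
  ∀ (c : C) (m : M), μₗ F c m ≫ a.app (c ⊙ₗ m) = c ⊴ₗ a.app m ≫ μₗ H c m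

theorem IsModNat.inv {a : F ≅ H} (ha : IsModNat C a.hom) : IsModNat C a.inv := by
  intro c m
  rw [← cancel_mono (a.hom.app (c ⊙ₗ m)), Category.assoc, Category.assoc, ha c m,
    ← actionHomRight_comp_assoc]
  simp

theorem InternalNat.ofIso_ev (I : InternalNat C F F') (a : F ≅ H) (b : F' ≅ H') (m : M) :
    (I.j m ≫ iHomPre C (a.inv.app m) (F'.obj m) ≫ iHomPost C (H.obj m) (b.hom.app m)) ⊵ₗ
      H.obj m ≫ iEv C (H.obj m) (H'.obj m) =
    I.obj.1 ⊴ₗ a.inv.app m ≫ I.j m ⊵ₗ F.obj m ≫ iEv C _ _ ≫ b.hom.app m := by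
  simp only [comp_actionHomLeft, Category.assoc]
  have h1 := iHomPre_ev (C := C) (a.inv.app m) (F'.obj m)
  rw [iHomPost_ev, reassoc_of% h1, ← action_exchange_assoc]

/-- Internal natural transformations only depend on the module functors up to module natural
isomorphism. -/
noncomputable def InternalNat.ofIso (I : InternalNat C F F') (a : F ≅ H) (b : F' ≅ H')
    (ha : IsModNat C a.hom) (hb : IsModNat C b.hom) : InternalNat C H H' where
  obj := I.obj
  j m := I.j m ≫ iHomPre C (a.inv.app m) (F'.obj m) ≫ iHomPost C (H.obj m) (b.hom.app m)
  dinat := by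
    refine (isDinat_iff _).2 ?_
    rw [funext (I.ofIso_ev a b)]
    intro m m' f
    have h1 := (isDinat_iff _).1 I.dinat f
    simp only [Category.assoc] at h1 ⊢
    rw [← actionHomRight_comp_assoc, a.inv.naturality, actionHomRight_comp_assoc,
      reassoc_of% h1, b.hom.naturality]
  exists_unique c φ hφ := by
    have hφ' := (isDinat_iff _).1 hφ
    obtain ⟨g, hg, hu⟩ := I.ev_universal c
      (fun m => c ⊴ₗ a.hom.app m ≫ φ m ⊵ₗ H.obj m ≫ iEv C _ _ ≫ b.inv.app m) (by
        intro m m' f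
        have h1 := hφ' f
        simp only [Category.assoc] at h1 ⊢
        rw [← actionHomRight_comp_assoc, a.hom.naturality, actionHomRight_comp_assoc,
          reassoc_of% h1, b.inv.naturality])
    refine ⟨g, fun m => iHom_ext ?_, fun g' hg' => hu g' fun m => ?_⟩
    · have h1 := hg m
      rw [comp_actionHomLeft, Category.assoc, I.ofIso_ev, ← action_exchange_assoc,
        reassoc_of% h1, ← actionHomRight_comp_assoc]
      simp
    · rw [← hg' m, comp_actionHomLeft, Category.assoc]
      have h1 := I.ofIso_ev a b m
      rw [reassoc_of% h1, ← action_exchange_assoc, ← actionHomRight_comp_assoc]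
      simp
  isMod := by
    rw [funext (I.ofIso_ev a b)]
    intro c m
    have h1 := I.isMod c m
    have hb1 := hb c m
    have ha1 : μₗ H c m ≫ a.inv.app (c ⊙ₗ m) = c ⊴ₗ a.inv.app m ≫ μₗ F c m := ha.inv c m
    have h2 := action_exchange (I.obj.2.β c).hom (a.inv.app m)
    simp only [tensor_actionHomRight, Category.assoc] at h1 h2 ⊢
    have h3 := congrArg (fun t => (αₗ I.obj.1 c (H.obj m)).inv ≫ t ≫ (αₗ c I.obj.1 _).hom) h2
    simp only [Category.assoc, Iso.inv_hom_id, Iso.inv_hom_id_assoc, Category.comp_id] at h3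
    rw [← actionHomRight_comp_assoc, ha1, actionHomRight_comp_assoc, reassoc_of% h1, hb1]
    simp only [actionHomRight_comp, Category.assoc]
    rw [reassoc_of% h3]

end Transport

end HorizontalProducts

section RightModules

open scoped MonoidalLeftAction MonObj

variable {C : Type u} [Category.{v} C] [MonoidalCategory C]

/-- Right modules over an algebra `A`, as bimodules over the tensor unit and `A`. -/
abbrev RMod (A : Mon C) := Bimod (Mon.trivial C) A

namespace RMod

variable {A : Mon C}

/-- The left action of the tensor unit on a right module is the left unitor. -/
theorem actLeft_eq (M : RMod A) : M.actLeft = (λ_ M.X).hom := by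
  have h := M.one_actLeft
  have h2 : (MonObj.one : 𝟙_ C ⟶ (Mon.trivial C).X) ▷ M.X = 𝟙 (𝟙_ C ⊗ M.X) :=
    id_whiskerRight _ _
  refine Eq.trans ?_ h
  refine Eq.trans ?_ (congrArg (fun t => t ≫ M.actLeft) h2).symm
  exact (Category.id_comp (show 𝟙_ C ⊗ M.X ⟶ M.X from M.actLeft)).symm

/-- A right module from its underlying object and its right action. -/
def mk (X : C) (act : X ⊗ A.X ⟶ X) (one : X ◁ η[A.X] ≫ act = (ρ_ X).hom)
    (assoc : X ◁ μ[A.X] ≫ act = (α_ X A.X A.X).inv ≫ act ▷ A.X ≫ act) : RMod A where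
  X := X
  actLeft := (λ_ X).hom
  one_actLeft := by
    have h2 : (MonObj.one : 𝟙_ C ⟶ (Mon.trivial C).X) ▷ X = 𝟙 (𝟙_ C ⊗ X) := id_whiskerRight _ _
    exact (congrArg (fun t => t ≫ (λ_ X).hom) h2).trans (Category.id_comp _)
  left_assoc := by
    change (λ_ (𝟙_ C)).hom ▷ X ≫ (λ_ X).hom = (α_ (𝟙_ C) (𝟙_ C) X).hom ≫
      𝟙_ C ◁ (λ_ X).hom ≫ (λ_ X).hom
    monoidal
  actRight := act
  actRight_one := one
  right_assoc := assoc
  middle_assoc := by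
    change (λ_ X).hom ▷ A.X ≫ act = (α_ (𝟙_ C) X A.X).hom ≫ 𝟙_ C ◁ act ≫ (λ_ X).hom
    simp

/-- A morphism of right modules from a morphism that respects the right actions. -/
def homMk {M N : RMod A} (f : M.X ⟶ N.X) (hf : M.actRight ≫ f = f ▷ A.X ≫ N.actRight) :
    M ⟶ N where
  hom := f
  left_act_hom := by
    rw [actLeft_eq, actLeft_eq]
    exact (leftUnitor_naturality f).symm
  right_act_hom := hf

theorem homMk_hom {M N : RMod A} (f : M.X ⟶ N.X)
    (hf : M.actRight ≫ f = f ▷ A.X ≫ N.actRight) : (homMk f hf).hom = f := rfl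

/-- An isomorphism of right modules from an isomorphism that respects the right actions. -/
def isoMk {M N : RMod A} (f : M.X ≅ N.X) (hf : M.actRight ≫ f.hom = f.hom ▷ A.X ≫ N.actRight) :
    M ≅ N where
  hom := homMk f.hom hf
  inv := homMk f.inv (by
    rw [← cancel_mono f.hom, Category.assoc, Category.assoc, Iso.inv_hom_id, hf,
      ← comp_whiskerRight_assoc]
    simp)
  hom_inv_id := Bimod.hom_ext _ _ f.hom_inv_id
  inv_hom_id := Bimod.hom_ext _ _ f.inv_hom_id

/-- The right module `c ⊗ M`, with action `id ⊗ ρ`. -/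
def act (c : C) (M : RMod A) : RMod A :=
  mk (c ⊗ M.X) ((α_ c M.X A.X).hom ≫ c ◁ M.actRight)
    (by
      rw [associator_naturality_right_assoc, ← MonoidalCategory.whiskerLeft_comp, M.actRight_one]
      simp)
    (by
      rw [associator_naturality_right_assoc, ← MonoidalCategory.whiskerLeft_comp, M.right_assoc]
      simp)

/-- The category of right modules is a left module category over `C`. -/
instance : MonoidalLeftAction C (RMod A) where
  actionObj := act
  actionHomLeft {c c'} f M := homMk (M := act c M) (N := act c' M) (f ▷ M.X) (by
    change ((α_ c M.X A.X).hom ≫ c ◁ M.actRight) ≫ f ▷ M.X = f ▷ M.X ▷ A.X ≫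
      (α_ c' M.X A.X).hom ≫ c' ◁ M.actRight
    rw [Category.assoc, whisker_exchange]
    simp)
  actionHomRight c {M N} f := homMk (M := act c M) (N := act c N) (c ◁ f.hom) (by
    change ((α_ c M.X A.X).hom ≫ c ◁ M.actRight) ≫ c ◁ f.hom = (c ◁ f.hom) ▷ A.X ≫
      (α_ c N.X A.X).hom ≫ c ◁ N.actRight
    rw [Category.assoc, ← MonoidalCategory.whiskerLeft_comp, Bimod.Hom.right_act_hom]
    simp)
  actionAssocIso c d M := isoMk (M := act (c ⊗ d) M) (N := act c (act d M)) (α_ c d M.X) (by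
    change ((α_ (c ⊗ d) M.X A.X).hom ≫ (c ⊗ d) ◁ M.actRight) ≫ (α_ c d M.X).hom =
      (α_ c d M.X).hom ▷ A.X ≫ (α_ c (d ⊗ M.X) A.X).hom ≫
        c ◁ ((α_ d M.X A.X).hom ≫ d ◁ M.actRight)
    simp)
  actionUnitIso M := isoMk (M := act (𝟙_ C) M) (N := M) (λ_ M.X) (by
    change ((α_ (𝟙_ C) M.X A.X).hom ≫ 𝟙_ C ◁ M.actRight) ≫ (λ_ M.X).hom =
      (λ_ M.X).hom ▷ A.X ≫ M.actRight
    simp)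
  actionHomRight_id c M := Bimod.hom_ext _ _ (whiskerLeft_id c M.X)
  id_actionHomLeft c M := Bimod.hom_ext _ _ (id_whiskerRight c M.X)
  actionHom_comp {c c' c'' M M' M''} f₁ f₂ g₁ g₂ := Bimod.hom_ext _ _ (by
    change (f₁ ≫ f₂) ▷ M.X ≫ c'' ◁ (g₁.hom ≫ g₂.hom) =
      (f₁ ▷ M.X ≫ c' ◁ g₁.hom) ≫ f₂ ▷ M'.X ≫ c'' ◁ g₂.hom
    simp only [comp_whiskerRight, MonoidalCategory.whiskerLeft_comp, Category.assoc]
    rw [whisker_exchange_assoc])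
  actionAssocIso_hom_naturality {c₁ c₂ c₃ c₄ M N} f g h := Bimod.hom_ext _ _ (by
    change ((f ⊗ₘ g) ▷ M.X ≫ (c₂ ⊗ c₄) ◁ h.hom) ≫ (α_ c₂ c₄ N.X).hom =
      (α_ c₁ c₃ M.X).hom ≫ f ▷ (c₃ ⊗ M.X) ≫ c₂ ◁ (g ▷ M.X ≫ c₄ ◁ h.hom)
    simp [MonoidalCategory.tensorHom_def])
  actionUnitIso_hom_naturality {M N} f := Bimod.hom_ext _ _ (leftUnitor_naturality f.hom).symm
  whiskerLeft_actionHomLeft c {c' c''} f M := Bimod.hom_ext _ _ (by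
    change (c ◁ f) ▷ M.X = (α_ c c' M.X).hom ≫ c ◁ f ▷ M.X ≫ (α_ c c'' M.X).inv
    simp)
  whiskerRight_actionHomLeft {c c'} c'' f M := Bimod.hom_ext _ _ (by
    change (f ▷ c'') ▷ M.X = (α_ c c'' M.X).hom ≫ f ▷ (c'' ⊗ M.X) ≫ (α_ c' c'' M.X).inv
    simp)
  associator_actionHom c₁ c₂ c₃ M := Bimod.hom_ext _ _ (pentagon c₁ c₂ c₃ M.X)
  leftUnitor_actionHom c M := Bimod.hom_ext _ _ (leftUnitor_whiskerRight c M.X)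
  rightUnitor_actionHom c M := Bimod.hom_ext _ _ (triangle c M.X).symm

variable (c d : C) (M N : RMod A)

theorem act_X : (c ⊙ₗ M : RMod A).X = (c ⊗ M.X) := rfl
theorem act_actRight : (c ⊙ₗ M : RMod A).actRight = (α_ c M.X A.X).hom ≫ c ◁ M.actRight := rfl
theorem actionHomLeft_hom {c d : C} (f : c ⟶ d) : (f ⊵ₗ M).hom = f ▷ M.X := rfl
theorem actionHomRight_hom {M N : RMod A} (f : M ⟶ N) : (c ⊴ₗ f).hom = c ◁ f.hom := rfl

end RMod

end RightModules

section ModuleHoms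

open scoped MonoidalLeftAction MonObj

variable {C : Type u} [Category.{v} C] [MonoidalCategory C]

theorem exists_hom_obj [RigidCategory C] (X Y : C) : ∃ (H : C) (ε : H ⊗ X ⟶ Y),
    ∀ (c : C) (f : c ⊗ X ⟶ Y), ∃! g : c ⟶ H, g ▷ X ≫ ε = f := by
  refine ⟨Y ⊗ Xᘁ, (tensorRightHomEquiv _ X Xᘁ Y).symm (𝟙 _), fun c f => ?_⟩
  have h : ∀ g : c ⟶ Y ⊗ Xᘁ, g ▷ X ≫ (tensorRightHomEquiv _ X Xᘁ Y).symm (𝟙 _) =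
      (tensorRightHomEquiv _ X Xᘁ Y).symm g := by
    intro g
    rw [← tensorRightHomEquiv_symm_naturality, Category.comp_id]
  refine ⟨tensorRightHomEquiv _ X Xᘁ Y f, ?_, fun g hg => ?_⟩
  · exact (h _).trans (Equiv.symm_apply_apply _ _)
  · rw [← hg, h, Equiv.apply_symm_apply]

namespace RMod

theorem nonempty_internalHom [RigidCategory C] [HasEqualizers C] {A : Mon C} (M N : RMod A) :
    Nonempty (InternalHom C M N) := by
  obtain ⟨H, ε, hH⟩ := exists_hom_obj M.X N.X
  obtain ⟨K, κ, hK⟩ := exists_hom_obj ((M.X ⊗ A.X : C)) N.X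
  obtain ⟨t₁, h₁, -⟩ := hK H (H ◁ M.actRight ≫ ε)
  obtain ⟨t₂, h₂, -⟩ := hK H ((α_ H M.X A.X).inv ≫ ε ▷ A.X ≫ N.actRight)
  have key : ∀ (c : C) (g : c ⟶ H), g ≫ t₁ = g ≫ t₂ ↔
      (α_ c M.X A.X).hom ≫ c ◁ M.actRight ≫ g ▷ M.X ≫ ε =
        (g ▷ M.X ≫ ε) ▷ A.X ≫ N.actRight := by
    intro c g
    have e₁ : (g ≫ t₁) ▷ (M.X ⊗ A.X) ≫ κ = c ◁ M.actRight ≫ g ▷ M.X ≫ ε := by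
      rw [comp_whiskerRight, Category.assoc, h₁, whisker_exchange_assoc]
    have e₂ : (g ≫ t₂) ▷ (M.X ⊗ A.X) ≫ κ = (α_ c M.X A.X).inv ≫ (g ▷ M.X ≫ ε) ▷ A.X ≫
        N.actRight := by
      rw [comp_whiskerRight, Category.assoc, h₂]; simp
    rw [← Iso.eq_inv_comp, ← e₁, ← e₂]
    exact ⟨fun h => by rw [h], fun h => (hK c _).unique h rfl⟩
  have hev := (key _ (equalizer.ι t₁ t₂)).1 (equalizer.condition t₁ t₂)
  refine ⟨⟨equalizer t₁ t₂, homMk (M := act (equalizer t₁ t₂) M) (equalizer.ι t₁ t₂ ▷ M.X ≫ ε)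
    ((Category.assoc _ _ _).trans hev), fun c f => ?_⟩⟩
  obtain ⟨f₀, hf₀⟩ : ∃ f₀ : c ⊗ M.X ⟶ N.X, f₀ = f.hom := ⟨_, rfl⟩
  obtain ⟨g, hg, hu⟩ := hH c f₀
  have hf : ((α_ c M.X A.X).hom ≫ c ◁ M.actRight) ≫ f₀ = f₀ ▷ A.X ≫ N.actRight := by
    rw [hf₀]; exact f.right_act_hom
  refine ⟨equalizer.lift g ((key c g).2 ?_), ?_, fun g' hg' => ?_⟩
  · rw [hg, ← hf, Category.assoc]
  · apply Bimod.hom_ext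
    refine Eq.trans ?_ hf₀
    change equalizer.lift g _ ▷ M.X ≫ equalizer.ι t₁ t₂ ▷ M.X ≫ ε = f₀
    rw [← comp_whiskerRight_assoc, equalizer.lift_ι, hg]
  · have hg'' : g' ▷ M.X ≫ equalizer.ι t₁ t₂ ▷ M.X ≫ ε = f₀ :=
      (congrArg (fun t => t.hom) hg').trans hf₀.symm
    apply equalizer.hom_ext
    rw [equalizer.lift_ι]
    refine hu _ ?_
    change (g' ≫ equalizer.ι t₁ t₂) ▷ M.X ≫ ε = f₀
    rw [comp_whiskerRight, Category.assoc, hg'']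

instance [RigidCategory C] [HasEqualizers C] {A : Mon C} : HasInternalHoms C (RMod A) :=
  ⟨nonempty_internalHom⟩

end RMod

end ModuleHoms

section Induction

open scoped MonoidalLeftAction MonObj

variable {C : Type u} [Category.{v} C] [MonoidalCategory C] [HasCoequalizers C]

section TensorAPI

variable {R S T U : Mon C} (P : Bimod R S) (Q : Bimod S T)

variable [∀ X : C, PreservesColimitsOfSize.{0, 0} (tensorLeft X)]
variable [∀ X : C, PreservesColimitsOfSize.{0, 0} (tensorRight X)]

/-- The projection from the tensor product in `C` to the relative tensor product. -/
noncomputable def relπ : P.X ⊗ Q.X ⟶ (P.tensorBimod Q).X :=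
  coequalizer.π (P.actRight ▷ Q.X) ((α_ _ _ _).hom ≫ (P.X ◁ Q.actLeft))

theorem relπ_condition : P.actRight ▷ Q.X ≫ relπ P Q =
    (α_ _ _ _).hom ≫ P.X ◁ Q.actLeft ≫ relπ P Q :=
  (coequalizer.condition (P.actRight ▷ Q.X) ((α_ _ _ _).hom ≫ (P.X ◁ Q.actLeft))).trans
    (Category.assoc _ _ _)

variable {P Q} in
/-- A morphism from the relative tensor product. -/
noncomputable def relDesc {W : C} (f : P.X ⊗ Q.X ⟶ W)
    (hf : P.actRight ▷ Q.X ≫ f = (α_ _ _ _).hom ≫ P.X ◁ Q.actLeft ≫ f) :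
    (P.tensorBimod Q).X ⟶ W :=
  coequalizer.desc f (hf.trans (Category.assoc _ _ _).symm)

variable {P Q} in
theorem relπ_desc {W : C} (f : P.X ⊗ Q.X ⟶ W)
    (hf : P.actRight ▷ Q.X ≫ f = (α_ _ _ _).hom ≫ P.X ◁ Q.actLeft ≫ f) :
    relπ P Q ≫ relDesc f hf = f := coequalizer.π_desc _ _

instance relπ_epi : Epi (relπ P Q) := inferInstanceAs (Epi (coequalizer.π _ _))

instance relπ_epi_left (c : C) : Epi (c ◁ relπ P Q) :=
  inferInstanceAs (Epi ((tensorLeft c).map (relπ P Q)))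

instance relπ_epi_right (c : C) : Epi (relπ P Q ▷ c) :=
  inferInstanceAs (Epi ((tensorRight c).map (relπ P Q)))

variable {P Q} in
theorem exists_relDesc_left {W c : C} (f : c ⊗ (P.X ⊗ Q.X) ⟶ W)
    (hf : c ◁ (P.actRight ▷ Q.X) ≫ f = c ◁ (α_ _ _ _).hom ≫ c ◁ (P.X ◁ Q.actLeft) ≫ f) :
    ∃ g : c ⊗ (P.tensorBimod Q).X ⟶ W, c ◁ relπ P Q ≫ g = f :=
  ⟨_, id_tensor_π_preserves_coequalizer_inv_desc (P.actRight ▷ Q.X)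
    ((α_ _ _ _).hom ≫ (P.X ◁ Q.actLeft)) f (by
      rw [hf, MonoidalCategory.whiskerLeft_comp, Category.assoc])⟩

theorem relπ_actRight : relπ P Q ▷ T.X ≫ (P.tensorBimod Q).actRight =
    (α_ _ _ _).hom ≫ P.X ◁ Q.actRight ≫ relπ P Q :=
  Bimod.TensorBimod.π_tensor_id_actRight P Q

variable {P} in
theorem relπ_whiskerRight {P' : Bimod R S} (f : P ⟶ P') :
    relπ P Q ≫ (Bimod.whiskerRight f Q).hom = f.hom ▷ Q.X ≫ relπ P' Q :=
  ι_colimMap (parallelPairHom _ _ _ _ (f.hom ▷ _ ▷ _) (f.hom ▷ _) _ _) WalkingParallelPair.one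

theorem relπ_associator (K : Bimod T U) :
    relπ P Q ▷ K.X ≫ relπ (P.tensorBimod Q) K ≫ (Bimod.associatorBimod P Q K).hom.hom =
      (α_ _ _ _).hom ≫ P.X ◁ relπ Q K ≫ relπ P (Q.tensorBimod K) := by
  have h : relπ (P.tensorBimod Q) K ≫ (Bimod.associatorBimod P Q K).hom.hom =
      Bimod.AssociatorBimod.homAux P Q K := coequalizer.π_desc _ _
  rw [h]
  exact π_tensor_id_preserves_coequalizer_inv_desc _ _ _ _

end TensorAPI

variable [∀ X : C, PreservesColimitsOfSize.{0, 0} (tensorLeft X)]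
variable [∀ X : C, PreservesColimitsOfSize.{0, 0} (tensorRight X)]
variable {A B D : Mon C} (X : Bimod A B)

/-- The functor `- ⊗_A X` from right `A`-modules to right `B`-modules. -/
noncomputable def induct : RMod A ⥤ RMod B where
  obj M := M.tensorBimod X
  map f := Bimod.whiskerRight f X
  map_id _ := Bimod.id_whiskerRight_bimod
  map_comp f g := Bimod.comp_whiskerRight_bimod f g X

theorem relπ_induct_map {M N : RMod A} (f : M ⟶ N) :
    relπ M X ≫ ((induct X).map f).hom = f.hom ▷ X.X ≫ relπ N X :=
  relπ_whiskerRight X f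

/-- The projection `M ⊗ X ⟶ M ⊗_A X`. -/
noncomputable def indπ (M : RMod A) : M.X ⊗ X.X ⟶ ((induct X).obj M).X := relπ M X

instance indπ_epi (M : RMod A) : Epi (indπ X M) := relπ_epi M X

instance indπ_epi_left (c : C) (M : RMod A) : Epi (c ◁ indπ X M) := relπ_epi_left M X c

instance indπ_epi_right (c : C) (M : RMod A) : Epi (indπ X M ▷ c) := relπ_epi_right M X c

instance indπ_epi_left_right (c d : C) (M : RMod A) : Epi ((c ◁ indπ X M) ▷ d) :=
  inferInstanceAs (Epi ((tensorRight d).map (c ◁ indπ X M)))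

/-- The projection `(c ⊗ M) ⊗ X ⟶ (c ⊗ M) ⊗_A X`. -/
noncomputable def actπ (c : C) (M : RMod A) :
    (c ⊗ M.X) ⊗ X.X ⟶ ((induct X).obj (c ⊙ₗ M)).X := relπ (c ⊙ₗ M : RMod A) X

theorem actπ_condition (c : C) (M : RMod A) :
    (α_ c M.X A.X).hom ▷ X.X ≫ (c ◁ M.actRight) ▷ X.X ≫ actπ X c M =
      (α_ (c ⊗ M.X) A.X X.X).hom ≫ (c ⊗ M.X) ◁ X.actLeft ≫ actπ X c M := by
  have h := relπ_condition (c ⊙ₗ M : RMod A) X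
  change ((α_ c M.X A.X).hom ≫ c ◁ M.actRight) ▷ X.X ≫ actπ X c M = (α_ (c ⊗ M.X) A.X X.X).hom ≫
    (c ⊗ M.X) ◁ X.actLeft ≫ actπ X c M at h
  rwa [comp_whiskerRight, Category.assoc] at h

theorem actπ_actRight (c : C) (M : RMod A) :
    actπ X c M ▷ B.X ≫ ((induct X).obj (c ⊙ₗ M)).actRight =
      (α_ (c ⊗ M.X) X.X B.X).hom ≫ (c ⊗ M.X) ◁ X.actRight ≫ actπ X c M :=
  relπ_actRight (c ⊙ₗ M : RMod A) X

theorem indπ_actRight (M : RMod A) : indπ X M ▷ B.X ≫ ((induct X).obj M).actRight =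
    (α_ M.X X.X B.X).hom ≫ M.X ◁ X.actRight ≫ indπ X M :=
  relπ_actRight M X

instance actπ_epi (c : C) (M : RMod A) : Epi (actπ X c M) := relπ_epi (c ⊙ₗ M : RMod A) X

instance actπ_epi_right (c d : C) (M : RMod A) : Epi (actπ X c M ▷ d) :=
  relπ_epi_right (c ⊙ₗ M : RMod A) X d

theorem exists_induct_mu (c : C) (M : RMod A) :
    ∃ g : c ⊗ ((induct X).obj M).X ⟶ ((induct X).obj (c ⊙ₗ M)).X,
      c ◁ indπ X M ≫ g = (α_ c M.X X.X).inv ≫ actπ X c M := by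
  refine exists_relDesc_left _ ?_
  have h := actπ_condition X c M
  have h1 : c ◁ (M.actRight ▷ X.X) ≫ (α_ c M.X X.X).inv =
      (α_ c (M.X ⊗ A.X) X.X).inv ≫ (c ◁ M.actRight) ▷ X.X := by simp
  have h2 : (α_ c (M.X ⊗ A.X) X.X).inv = c ◁ (α_ _ _ _).hom ≫ (α_ c M.X (A.X ⊗ X.X)).inv ≫
      (α_ (c ⊗ M.X) A.X X.X).inv ≫ (α_ c M.X A.X).hom ▷ X.X := by simp
  rw [reassoc_of% h1, h2]
  simp only [Category.assoc]
  rw [h]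
  simp

/-- The underlying morphism of the structure morphism of `- ⊗_A X`. -/
noncomputable def muC (c : C) (M : RMod A) :
    c ⊗ ((induct X).obj M).X ⟶ ((induct X).obj (c ⊙ₗ M)).X := (exists_induct_mu X c M).choose

theorem indπ_muC (c : C) (M : RMod A) :
    c ◁ indπ X M ≫ muC X c M = (α_ c M.X X.X).inv ≫ actπ X c M :=
  (exists_induct_mu X c M).choose_spec

/-- The structure morphism `c ⊗ (M ⊗_A X) ⟶ (c ⊗ M) ⊗_A X`. -/
noncomputable def inductMu (c : C) (M : RMod A) :
    c ⊙ₗ (induct X).obj M ⟶ (induct X).obj (c ⊙ₗ M) :=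
  RMod.homMk (muC X c M) (by
    have hg := indπ_muC X c M
    generalize muC X c M = g at hg
    change ((α_ c ((induct X).obj M).X B.X).hom ≫ c ◁ ((induct X).obj M).actRight) ≫ g =
      g ▷ B.X ≫ _
    rw [← cancel_epi ((c ◁ indπ X M) ▷ B.X)]
    have h1 := indπ_actRight X M
    have h2 := actπ_actRight X c M
    have h3 : (c ◁ indπ X M) ▷ B.X ≫ (α_ c ((induct X).obj M).X B.X).hom =
      (α_ _ _ _).hom ≫ c ◁ indπ X M ▷ B.X := associator_naturality_middle _ _ _
    rw [← comp_whiskerRight_assoc, hg, comp_whiskerRight, Category.assoc, Category.assoc, h2,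
      reassoc_of% h3, ← MonoidalCategory.whiskerLeft_comp_assoc, h1]
    simp only [MonoidalCategory.whiskerLeft_comp, Category.assoc, hg]
    simp)

theorem exists_induct_delta (c : C) (M : RMod A) :
    ∃ g : ((induct X).obj (c ⊙ₗ M)).X ⟶ c ⊗ ((induct X).obj M).X,
      actπ X c M ≫ g = (α_ c M.X X.X).hom ≫ c ◁ indπ X M := by
  refine ⟨relDesc (P := (c ⊙ₗ M : RMod A)) ((α_ c M.X X.X).hom ≫ c ◁ indπ X M) ?_,
    relπ_desc _ _⟩
  change ((α_ c M.X A.X).hom ≫ c ◁ M.actRight) ▷ X.X ≫ (α_ c M.X X.X).hom ≫ c ◁ indπ X M =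
    (α_ (c ⊗ M.X) A.X X.X).hom ≫ (c ⊗ M.X) ◁ X.actLeft ≫ (α_ c M.X X.X).hom ≫ c ◁ indπ X M
  have h : c ◁ M.actRight ▷ X.X ≫ c ◁ indπ X M =
      c ◁ (α_ M.X A.X X.X).hom ≫ c ◁ M.X ◁ X.actLeft ≫ c ◁ indπ X M := by
    simp only [← MonoidalCategory.whiskerLeft_comp]
    exact congrArg (fun t => c ◁ t) (relπ_condition M X)
  have h1 : (c ◁ M.actRight) ▷ X.X ≫ (α_ c M.X X.X).hom =
      (α_ c (M.X ⊗ A.X) X.X).hom ≫ c ◁ M.actRight ▷ X.X := associator_naturality_middle _ _ _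
  rw [comp_whiskerRight, Category.assoc, reassoc_of% h1, h]
  simp

/-- The underlying morphism of the inverse structure morphism of `- ⊗_A X`. -/
noncomputable def deltaC (c : C) (M : RMod A) :
    ((induct X).obj (c ⊙ₗ M)).X ⟶ c ⊗ ((induct X).obj M).X := (exists_induct_delta X c M).choose

theorem actπ_deltaC (c : C) (M : RMod A) :
    actπ X c M ≫ deltaC X c M = (α_ c M.X X.X).hom ≫ c ◁ indπ X M :=
  (exists_induct_delta X c M).choose_spec

/-- The inverse structure morphism `(c ⊗ M) ⊗_A X ⟶ c ⊗ (M ⊗_A X)`. -/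
noncomputable def inductDelta (c : C) (M : RMod A) :
    (induct X).obj (c ⊙ₗ M) ⟶ c ⊙ₗ (induct X).obj M :=
  RMod.homMk (deltaC X c M) (by
    have hg := actπ_deltaC X c M
    generalize deltaC X c M = g at hg
    change _ ≫ g = g ▷ B.X ≫ (α_ c ((induct X).obj M).X B.X).hom ≫ c ◁ ((induct X).obj M).actRight
    rw [← cancel_epi (actπ X c M ▷ B.X)]
    have h1 := indπ_actRight X M
    have h2 := actπ_actRight X c M
    have h3 : (c ◁ indπ X M) ▷ B.X ≫ (α_ c ((induct X).obj M).X B.X).hom =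
      (α_ _ _ _).hom ≫ c ◁ indπ X M ▷ B.X := associator_naturality_middle _ _ _
    rw [reassoc_of% h2, hg, ← comp_whiskerRight_assoc, hg, comp_whiskerRight, Category.assoc,
      reassoc_of% h3, ← MonoidalCategory.whiskerLeft_comp, h1]
    simp)

theorem indπ_map {M N : RMod A} (f : M ⟶ N) :
    indπ X M ≫ ((induct X).map f).hom = f.hom ▷ X.X ≫ indπ X N :=
  relπ_whiskerRight X f

theorem actπ_map_right (c : C) {M N : RMod A} (f : M ⟶ N) :
    actπ X c M ≫ ((induct X).map (c ⊴ₗ f)).hom = (c ◁ f.hom) ▷ X.X ≫ actπ X c N :=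
  relπ_whiskerRight X (c ⊴ₗ f)

theorem actπ_map_left {c d : C} (f : c ⟶ d) (M : RMod A) :
    actπ X c M ≫ ((induct X).map (f ⊵ₗ M)).hom = (f ▷ M.X) ▷ X.X ≫ actπ X d M :=
  relπ_whiskerRight X (f ⊵ₗ M)

theorem actπ_map_unit (M : RMod A) :
    actπ X (𝟙_ C) M ≫ ((induct X).map (MonoidalLeftAction.actionUnitIso M).hom).hom =
      (λ_ M.X).hom ▷ X.X ≫ indπ X M :=
  relπ_whiskerRight X (MonoidalLeftAction.actionUnitIso M : 𝟙_ C ⊙ₗ M ≅ M).hom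

/-- The projection `(c ⊗ (d ⊗ M)) ⊗ X ⟶ (c ⊗ (d ⊗ M)) ⊗_A X`. -/
noncomputable def actπ₂ (c d : C) (M : RMod A) :
    (c ⊗ d ⊗ M.X) ⊗ X.X ⟶ ((induct X).obj (c ⊙ₗ d ⊙ₗ M)).X := actπ X c (d ⊙ₗ M : RMod A)

theorem actπ_map_assoc (c d : C) (M : RMod A) :
    actπ X (c ⊗ d) M ≫ ((induct X).map (MonoidalLeftAction.actionAssocIso c d M).hom).hom =
      (α_ c d M.X).hom ▷ X.X ≫ actπ₂ X c d M :=
  relπ_whiskerRight X (MonoidalLeftAction.actionAssocIso c d M).hom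

theorem actπ_muC (c d : C) (M : RMod A) :
    c ◁ actπ X d M ≫ muC X c (d ⊙ₗ M) = (α_ c (d ⊗ M.X) X.X).inv ≫ actπ₂ X c d M :=
  indπ_muC X c (d ⊙ₗ M)

/-- The functor `- ⊗_A X` is a module functor. -/
noncomputable instance inductLeftLinear : (induct X).LeftLinear C where
  μₗ c M := inductMu X c M
  δₗ c M := inductDelta X c M
  μₗ_naturality_left {c d} f M := Bimod.hom_ext _ _ (by
    change (f ▷ ((induct X).obj M).X) ≫ muC X d M =
      muC X c M ≫ ((induct X).map (f ⊵ₗ M)).hom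
    rw [← cancel_epi (c ◁ indπ X M), whisker_exchange_assoc, indπ_muC,
      reassoc_of% indπ_muC X c M, actπ_map_left]
    simp)
  μₗ_naturality_right c {M N} f := Bimod.hom_ext _ _ (by
    change c ◁ ((induct X).map f).hom ≫ muC X c N =
      muC X c M ≫ ((induct X).map (c ⊴ₗ f)).hom
    rw [← cancel_epi (c ◁ indπ X M), ← MonoidalCategory.whiskerLeft_comp_assoc, indπ_map,
      reassoc_of% indπ_muC X c M, actπ_map_right, MonoidalCategory.whiskerLeft_comp,
      Category.assoc, indπ_muC]
    simp)
  μₗ_associativity c d M := Bimod.hom_ext _ _ (by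
    change muC X (c ⊗ d) M ≫
        ((induct X).map (MonoidalLeftAction.actionAssocIso c d M).hom).hom =
      (α_ c d ((induct X).obj M).X).hom ≫ c ◁ muC X d M ≫
        muC X c (d ⊙ₗ M)
    rw [← cancel_epi ((c ⊗ d) ◁ indπ X M), reassoc_of% indπ_muC X (c ⊗ d) M,
      actπ_map_assoc, associator_naturality_right_assoc,
      ← MonoidalCategory.whiskerLeft_comp_assoc, indπ_muC,
      MonoidalCategory.whiskerLeft_comp, Category.assoc, actπ_muC]
    simp)
  μₗ_unitality M := Bimod.hom_ext _ _ (by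
    change (λ_ ((induct X).obj M).X).hom = muC X (𝟙_ C) M ≫
      ((induct X).map (MonoidalLeftAction.actionUnitIso M).hom).hom
    rw [← cancel_epi (𝟙_ C ◁ indπ X M), reassoc_of% indπ_muC X (𝟙_ C) M, actπ_map_unit]
    simp)
  δₗ_naturality_left {c d} f M := Bimod.hom_ext _ _ (by
    change ((induct X).map (f ⊵ₗ M)).hom ≫ deltaC X d M =
      deltaC X c M ≫ (f ▷ ((induct X).obj M).X)
    rw [← cancel_epi (actπ X c M), reassoc_of% actπ_map_left X f M, actπ_deltaC,
      reassoc_of% actπ_deltaC X c M, whisker_exchange]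
    simp)
  δₗ_naturality_right c {M N} f := Bimod.hom_ext _ _ (by
    change ((induct X).map (c ⊴ₗ f)).hom ≫ deltaC X c N =
      deltaC X c M ≫ c ◁ ((induct X).map f).hom
    rw [← cancel_epi (actπ X c M), reassoc_of% actπ_map_right X c f, actπ_deltaC,
      reassoc_of% actπ_deltaC X c M, ← MonoidalCategory.whiskerLeft_comp, indπ_map]
    simp)
  δₗ_associativity c d M := Bimod.hom_ext _ _ (by
    change deltaC X (c ⊗ d) M ≫ (α_ c d ((induct X).obj M).X).hom =
      ((induct X).map (MonoidalLeftAction.actionAssocIso c d M).hom).hom ≫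
        deltaC X c (d ⊙ₗ M) ≫ c ◁ deltaC X d M
    have h : actπ₂ X c d M ≫ deltaC X c (d ⊙ₗ M) =
      (α_ c (d ⊗ M.X) X.X).hom ≫ c ◁ actπ X d M := actπ_deltaC X c (d ⊙ₗ M)
    rw [← cancel_epi (actπ X (c ⊗ d) M), reassoc_of% actπ_deltaC X (c ⊗ d) M,
      reassoc_of% actπ_map_assoc X c d M, reassoc_of% h, ← MonoidalCategory.whiskerLeft_comp,
      actπ_deltaC]
    simp)
  δₗ_unitality_inv M := Bimod.hom_ext _ _ (by
    change (λ_ ((induct X).obj M).X).inv =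
      ((induct X).map (MonoidalLeftAction.actionUnitIso M).inv).hom ≫
        deltaC X (𝟙_ C) M
    have h : indπ X M ≫ ((induct X).map
      (MonoidalLeftAction.actionUnitIso M : 𝟙_ C ⊙ₗ M ≅ M).inv).hom =
        (λ_ M.X).inv ▷ X.X ≫ actπ X (𝟙_ C) M := indπ_map X _
    rw [← cancel_epi (indπ X M), reassoc_of% h, actπ_deltaC]
    simp)
  μₗ_comp_δₗ c M := Bimod.hom_ext _ _ (by
    change muC X c M ≫ deltaC X c M = 𝟙 _
    rw [← cancel_epi (c ◁ indπ X M), reassoc_of% indπ_muC X c M, actπ_deltaC]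
    simp)
  δₗ_comp_μₗ c M := Bimod.hom_ext _ _ (by
    change deltaC X c M ≫ muC X c M = 𝟙 _
    rw [← cancel_epi (actπ X c M), reassoc_of% actπ_deltaC X c M, indπ_muC]
    simp)

end Induction

section Composition

open scoped MonoidalLeftAction MonObj

variable {C : Type u} [Category.{v} C] [MonoidalCategory C] [HasCoequalizers C]
variable [∀ X : C, PreservesColimitsOfSize.{0, 0} (tensorLeft X)]
variable [∀ X : C, PreservesColimitsOfSize.{0, 0} (tensorRight X)]
variable {A B D : Mon C} (X : Bimod A B) (Y : Bimod B D)

/-- The natural isomorphism `(- ⊗_A X) ⊗_B Y ≅ - ⊗_A (X ⊗_B Y)`. -/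
noncomputable def inductComp : induct X ⋙ induct Y ≅ induct (X.tensorBimod Y) :=
  NatIso.ofComponents (fun M => Bimod.associatorBimod M X Y) (fun {M N} f => by
    change Bimod.whiskerRight (Bimod.whiskerRight f X) Y ≫ (Bimod.associatorBimod N X Y).hom =
      (Bimod.associatorBimod M X Y).hom ≫ Bimod.whiskerRight f (X.tensorBimod Y)
    rw [Bimod.whiskerRight_comp_bimod]
    simp)

theorem indπ_inductComp (M : RMod A) :
    indπ X M ▷ Y.X ≫ indπ Y ((induct X).obj M) ≫ ((inductComp X Y).hom.app M).hom =
      (α_ M.X X.X Y.X).hom ≫ M.X ◁ relπ X Y ≫ indπ (X.tensorBimod Y) M :=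
  relπ_associator M X Y

theorem actπ_inductComp (c : C) (M : RMod A) :
    actπ X c M ▷ Y.X ≫ indπ Y ((induct X).obj (c ⊙ₗ M)) ≫
        ((inductComp X Y).hom.app (c ⊙ₗ M)).hom =
      (α_ (c ⊗ M.X) X.X Y.X).hom ≫ (c ⊗ M.X) ◁ relπ X Y ≫ actπ (X.tensorBimod Y) c M :=
  relπ_associator (c ⊙ₗ M : RMod A) X Y

theorem inductComp_isModNat : IsModNat C (inductComp X Y).hom := by
  intro c M
  apply Bimod.hom_ext
  change (muC Y c ((induct X).obj M) ≫ ((induct Y).map (inductMu X c M)).hom) ≫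
    ((inductComp X Y).hom.app (c ⊙ₗ M)).hom =
      c ◁ ((inductComp X Y).hom.app M).hom ≫ muC (X.tensorBimod Y) c M
  have h1 : actπ Y c ((induct X).obj M) ≫ ((induct Y).map (inductMu X c M)).hom =
      muC X c M ▷ Y.X ≫ indπ Y ((induct X).obj (c ⊙ₗ M)) := indπ_map Y (inductMu X c M)
  have h2 := congrArg (fun t => c ◁ t) (indπ_inductComp X Y M)
  simp only [MonoidalCategory.whiskerLeft_comp] at h2
  have h3 : (c ◁ indπ X M) ▷ Y.X ≫ muC X c M ▷ Y.X =
      (α_ c M.X X.X).inv ▷ Y.X ≫ actπ X c M ▷ Y.X := by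
    rw [← comp_whiskerRight, indπ_muC, comp_whiskerRight]
  have h4 := indπ_muC Y c ((induct X).obj M)
  have e : Epi (c ◁ (indπ X M ▷ Y.X)) :=
    inferInstanceAs (Epi ((tensorLeft c).map (indπ X M ▷ Y.X)))
  rw [← cancel_epi (c ◁ indπ Y ((induct X).obj M)), ← cancel_epi (c ◁ (indπ X M ▷ Y.X)),
    Category.assoc, reassoc_of% h4, reassoc_of% h1, reassoc_of% h2,
    associator_inv_naturality_middle_assoc, reassoc_of% h3, actπ_inductComp, indπ_muC]
  simp

end Composition

section LinearModules

open scoped MonoidalLeftAction MonObj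

variable {C : Type u} [Category.{v} C] [MonoidalCategory C] [Preadditive C]
  [MonoidalPreadditive C] {A B : Mon C}

namespace RMod

theorem hom_injective (M N : RMod A) :
    Function.Injective (fun f : M ⟶ N => (f.hom : M.X ⟶ N.X)) :=
  fun _ _ h => Bimod.hom_ext _ _ h

variable (M N : RMod A)

instance : Zero (M ⟶ N) := ⟨homMk 0 (by simp)⟩
instance : Add (M ⟶ N) := ⟨fun f g => homMk (f.hom + g.hom) (by
  rw [Preadditive.comp_add, f.right_act_hom, g.right_act_hom, MonoidalPreadditive.add_whiskerRight,
    Preadditive.add_comp])⟩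
instance : Neg (M ⟶ N) := ⟨fun f => homMk (-f.hom) (by
  have h : (-f.hom) ▷ A.X = -(f.hom ▷ A.X) :=
    ((tensorRight A.X).map_neg (f := f.hom) :)
  rw [Preadditive.comp_neg, f.right_act_hom, h, Preadditive.neg_comp])⟩
instance : Sub (M ⟶ N) := ⟨fun f g => homMk (f.hom - g.hom) (by
  have h : (f.hom - g.hom) ▷ A.X = f.hom ▷ A.X - g.hom ▷ A.X :=
    ((tensorRight A.X).map_sub (f := f.hom) (g := g.hom) :)
  rw [Preadditive.comp_sub, f.right_act_hom, g.right_act_hom, h, Preadditive.sub_comp])⟩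
instance : SMul ℕ (M ⟶ N) := ⟨fun n f => homMk (n • f.hom) (by
  have h : (n • f.hom) ▷ A.X = n • (f.hom ▷ A.X) :=
    ((tensorRight A.X).map_nsmul (f := f.hom) (n := n) :)
  rw [Preadditive.comp_nsmul, f.right_act_hom, h, Preadditive.nsmul_comp])⟩
instance : SMul ℤ (M ⟶ N) := ⟨fun n f => homMk (n • f.hom) (by
  have h : (n • f.hom) ▷ A.X = n • (f.hom ▷ A.X) :=
    ((tensorRight A.X).map_zsmul (f := f.hom) (r := n) :)
  rw [Preadditive.comp_zsmul, f.right_act_hom, h, Preadditive.zsmul_comp])⟩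

/-- Right modules form a preadditive category. -/
instance : Preadditive (RMod A) where
  homGroup M N := (hom_injective M N).addCommGroup _ rfl (fun _ _ => rfl) (fun _ => rfl)
    (fun _ _ => rfl) (fun _ _ => rfl) (fun _ _ => rfl)
  add_comp M N K f f' g := Bimod.hom_ext _ _ (Preadditive.add_comp _ _ _ f.hom f'.hom g.hom)
  comp_add M N K f g g' := Bimod.hom_ext _ _ (Preadditive.comp_add _ _ _ f.hom g.hom g'.hom)

theorem add_hom {M N : RMod A} (f g : M ⟶ N) : (f + g).hom = f.hom + g.hom := rfl

/-- The forgetful homomorphism from module morphisms to morphisms. -/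
def homAddHom : (M ⟶ N) →+ (M.X ⟶ N.X) where
  toFun f := f.hom
  map_zero' := rfl
  map_add' _ _ := rfl

theorem sum_hom {M N : RMod A} {J : Type w} (s : Finset J) (f : J → (M ⟶ N)) :
    (∑ i ∈ s, f i).hom = ∑ i ∈ s, (f i).hom := map_sum (homAddHom M N) f s

variable (k : Type w) [Field k] [Linear k C] [MonoidalLinear k C]

instance : SMul k (M ⟶ N) := ⟨fun r f => homMk (r • f.hom) (by
  rw [Linear.comp_smul, f.right_act_hom, MonoidalLinear.smul_whiskerRight, Linear.smul_comp])⟩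

/-- The module structure on module morphisms. -/
instance homModule : Module k (M ⟶ N) :=
  (hom_injective M N).module k (homAddHom M N) (fun _ _ => rfl)

/-- Right modules form a linear category. -/
instance : Linear k (RMod A) where
  homModule M N := homModule M N k
  smul_comp M N K r f g := Bimod.hom_ext _ _ (Linear.smul_comp _ _ _ r f.hom g.hom)
  comp_smul M N K f r g := Bimod.hom_ext _ _ (Linear.comp_smul _ _ _ f.hom r g.hom)

/-- The forgetful linear map from module morphisms to morphisms. -/
def homLinear : (M ⟶ N) →ₗ[k] (M.X ⟶ N.X) where
  toFun f := f.hom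
  map_add' _ _ := rfl
  map_smul' _ _ := rfl

variable {M N}

theorem act_add (c : C) (f g : M ⟶ N) : c ⊴ₗ (f + g) = c ⊴ₗ f + c ⊴ₗ g :=
  Bimod.hom_ext _ _ (MonoidalPreadditive.whiskerLeft_add f.hom g.hom)

theorem act_smul (c : C) (r : k) (f : M ⟶ N) : c ⊴ₗ (r • f) = r • (c ⊴ₗ f) :=
  Bimod.hom_ext _ _ (MonoidalLinear.whiskerLeft_smul c r f.hom)

end RMod

section

variable [HasCoequalizers C] [∀ X : C, PreservesColimitsOfSize.{0, 0} (tensorLeft X)]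
variable [∀ X : C, PreservesColimitsOfSize.{0, 0} (tensorRight X)]
variable (X : Bimod A B)

instance : (induct X).Additive where
  map_add {M N f g} := Bimod.hom_ext _ _ (by
    rw [← cancel_epi (indπ X M), indπ_map, RMod.add_hom, RMod.add_hom, Preadditive.comp_add,
      indπ_map, indπ_map, MonoidalPreadditive.add_whiskerRight, Preadditive.add_comp])

instance (k : Type w) [Field k] [Linear k C] [MonoidalLinear k C] : (induct X).Linear k where
  map_smul {M N} f r := Bimod.hom_ext _ _ (by
    change _ = r • ((induct X).map f).hom
    rw [← cancel_epi (indπ X M), indπ_map]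
    change (r • f.hom) ▷ X.X ≫ _ = _
    rw [Linear.comp_smul,
      indπ_map, MonoidalLinear.smul_whiskerRight, Linear.smul_comp])

end

end LinearModules

section EndExistence

open scoped MonoidalLeftAction MonObj
open MonoidalLeftAction

variable {C : Type u} [Category.{v} C] [MonoidalCategory C] [Preadditive C]
  [MonoidalPreadditive C] [RigidCategory C] [HasEqualizers C] [HasFiniteProducts C]
variable (k : Type w) [Field k] [Linear k C] [MonoidalLinear k C]
variable {A B : Mon C} (F F' : RMod A ⥤ RMod B) [F.Additive] [F'.Additive] [F.Linear k]
  [F'.Linear k]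

theorem RMod.act_sum {M N : RMod A} (c : C) {n : ℕ} (f : Fin n → (M ⟶ N)) :
    c ⊴ₗ (∑ i, f i) = ∑ i, c ⊴ₗ f i := by
  let φ : (M ⟶ N) →+ (c ⊙ₗ M ⟶ c ⊙ₗ N) :=
    AddMonoidHom.mk' (fun f => c ⊴ₗ f) (fun f g => RMod.act_add c f g)
  exact map_sum φ f _

/-- The end of internal Homs exists for linear functors on a category of right modules with a
finite-dimensional generator. -/
theorem exists_end (P : RMod A) {r : ℕ} (b : Fin r → (P ⟶ P))
    (hb : Submodule.span k (Set.range b) = ⊤)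
    (hP : ∀ M : RMod A, ∃ (n : ℕ) (p : Fin n → (M ⟶ P)) (q : Fin n → (P ⟶ M)),
      ∑ i, p i ≫ q i = 𝟙 M) :
    ∃ (E : C) (e : ∀ M, E ⊙ₗ F.obj M ⟶ F'.obj M), IsNatFam E F F' e ∧
      ∀ (c : C) (φ : ∀ M, c ⊙ₗ F.obj M ⟶ F'.obj M), IsNatFam c F F' φ →
        ∃! g : c ⟶ E, ∀ M, g ⊵ₗ F.obj M ≫ e M = φ M := by
  let H : C := iHom C (F.obj P) (F'.obj P)
  let post : (P ⟶ P) → (H ⟶ iHom C (F.obj P) (F'.obj P)) := fun f =>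
    iHomPost C (F.obj P) (F'.map f)
  let pre : (P ⟶ P) → (H ⟶ iHom C (F.obj P) (F'.obj P)) := fun f =>
    iHomPre C (F.map f) (F'.obj P)
  let s : H ⟶ ∏ᶜ fun _ : Fin r => H := Pi.lift fun i => post (b i)
  let t : H ⟶ ∏ᶜ fun _ : Fin r => H := Pi.lift fun i => pre (b i)
  let E : C := equalizer s t
  have key : ∀ (c : C) (g : c ⟶ H) (f : P ⟶ P), g ≫ post f = g ≫ pre f ↔
      c ⊴ₗ F.map f ≫ g ⊵ₗ F.obj P ≫ iEv C _ _ = (g ⊵ₗ F.obj P ≫ iEv C _ _) ≫ F'.map f := by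
    intro c g f
    have h₁ : (g ≫ post f) ⊵ₗ F.obj P ≫ iEv C _ _ = (g ⊵ₗ F.obj P ≫ iEv C _ _) ≫ F'.map f := by
      rw [comp_actionHomLeft, Category.assoc, iHomPost_ev, Category.assoc]
    have h₂ : (g ≫ pre f) ⊵ₗ F.obj P ≫ iEv C _ _ =
        c ⊴ₗ F.map f ≫ g ⊵ₗ F.obj P ≫ iEv C _ _ := by
      rw [comp_actionHomLeft, Category.assoc, iHomPre_ev, action_exchange_assoc]
    rw [← h₁, ← h₂]
    exact ⟨fun h => by rw [h], fun h => iHom_ext h.symm⟩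
  have hι : ∀ i, equalizer.ι s t ≫ post (b i) = equalizer.ι s t ≫ pre (b i) := by
    intro i
    have h := congrArg (fun x => x ≫ Pi.π (fun _ : Fin r => H) i) (equalizer.condition s t)
    simpa [s, t] using h
  let eP : E ⊙ₗ F.obj P ⟶ F'.obj P := equalizer.ι s t ⊵ₗ F.obj P ≫ iEv C _ _
  have natP : ∀ f : P ⟶ P, E ⊴ₗ F.map f ≫ eP = eP ≫ F'.map f := by
    let S : Submodule k (P ⟶ P) :=
      { carrier := {f | E ⊴ₗ F.map f ≫ eP = eP ≫ F'.map f}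
        add_mem' := by
          intro f g hf hg
          simp only [Set.mem_setOf_eq] at hf hg ⊢
          rw [F.map_add, F'.map_add, RMod.act_add, Preadditive.add_comp, Preadditive.comp_add,
            hf, hg]
        zero_mem' := by
          simp only [Set.mem_setOf_eq]
          have h0 : E ⊴ₗ (0 : F.obj P ⟶ F.obj P) = 0 := Bimod.hom_ext _ _
            (MonoidalPreadditive.whiskerLeft_zero)
          rw [F.map_zero, F'.map_zero, h0, zero_comp, comp_zero]
        smul_mem' := by
          intro x f hf
          simp only [Set.mem_setOf_eq] at hf ⊢
          rw [F.map_smul, F'.map_smul, RMod.act_smul, Linear.smul_comp, Linear.comp_smul, hf] }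
    have hS : Submodule.span k (Set.range b) ≤ S := by
      rw [Submodule.span_le]
      rintro _ ⟨i, rfl⟩
      exact (key E (equalizer.ι s t) (b i)).1 (hι i)
    intro f
    exact hS (hb ▸ Submodule.mem_top)
  choose n p q hpq using hP
  let e : ∀ M, E ⊙ₗ F.obj M ⟶ F'.obj M := fun M =>
    ∑ i, E ⊴ₗ F.map (p M i) ≫ eP ≫ F'.map (q M i)
  have h1 : ∀ (M : RMod A) (g : P ⟶ M), E ⊴ₗ F.map g ≫ e M = eP ≫ F'.map g := by
    intro M g
    calc E ⊴ₗ F.map g ≫ e M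
        = ∑ i, E ⊴ₗ F.map (g ≫ p M i) ≫ eP ≫ F'.map (q M i) := by
          simp only [e, Preadditive.comp_sum, F.map_comp, actionHomRight_comp, Category.assoc]
      _ = ∑ i, eP ≫ F'.map (g ≫ p M i ≫ q M i) := by
          refine Finset.sum_congr rfl fun i _ => ?_
          have := natP (g ≫ p M i)
          rw [reassoc_of% this, ← F'.map_comp]
          simp only [eP, Category.assoc]
      _ = eP ≫ F'.map g := by
          rw [← Preadditive.comp_sum, ← Functor.map_sum, ← Preadditive.comp_sum, hpq,
            Category.comp_id]
  have h2 : ∀ (c : C) {M K : RMod A} (f : M ⟶ K), c ⊴ₗ F.map f =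
      ∑ i, c ⊴ₗ F.map (p M i) ≫ c ⊴ₗ F.map (q M i ≫ f) := by
    intro c M K f
    simp only [← actionHomRight_comp, ← F.map_comp]
    rw [← RMod.act_sum, ← Functor.map_sum]
    simp only [← Category.assoc]
    rw [← Preadditive.sum_comp, hpq, Category.id_comp]
  refine ⟨E, e, ?_, ?_⟩
  · intro M K f
    rw [h2 E f, Preadditive.sum_comp]
    simp only [e, Preadditive.sum_comp, Category.assoc, ← F'.map_comp]
    refine Finset.sum_congr rfl fun i _ => ?_
    have := h1 K (q M i ≫ f)
    rw [← this]
  · intro c φ hφ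
    obtain ⟨g₀, hg₀, hu⟩ := iHom_exists_unique (φ P)
    have hcond : g₀ ≫ s = g₀ ≫ t := by
      refine Pi.hom_ext _ _ fun i => ?_
      have := (key c g₀ (b i)).2 (by rw [hg₀]; exact hφ (b i))
      simpa [s, t] using this
    have hlift : (equalizer.lift g₀ hcond : c ⟶ E) ⊵ₗ F.obj P ≫ eP = φ P := by
      simp only [eP]
      rw [← comp_actionHomLeft_assoc, equalizer.lift_ι, hg₀]
    have hid : ∀ M, c ⊴ₗ F.map (𝟙 M) ≫ φ M = φ M := by intro M; simp
    refine ⟨equalizer.lift g₀ hcond, fun M => ?_, fun g' hg' => ?_⟩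
    · rw [← hid M, h2 c (𝟙 M), Preadditive.sum_comp]
      simp only [e, Preadditive.comp_sum, Category.comp_id, Category.assoc]
      refine Finset.sum_congr rfl fun i _ => ?_
      rw [hφ (q M i), ← hlift, ← action_exchange_assoc]
      simp only [eP, Category.assoc]
    · apply equalizer.hom_ext
      rw [equalizer.lift_ι]
      refine hu _ ?_
      have he : e P = eP := by
        have := h1 P (𝟙 P)
        simpa using this
      have := hg' P
      rw [he] at this
      simp only [comp_actionHomLeft, Category.assoc]
      exact this

end EndExistence

section Fusion

open scoped MonoidalLeftAction MonObj ComonObj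
open MonoidalLeftAction

attribute [local instance] Abelian.hasFiniteBiproducts

instance tensorLeft_preservesColimits {C : Type u} [Category.{v} C] [MonoidalCategory C]
    [RigidCategory C] (X : C) : PreservesColimitsOfSize.{0, 0} (tensorLeft X) :=
  (tensorLeftAdjunction (ᘁX) X).leftAdjoint_preservesColimits

instance tensorRight_preservesColimits {C : Type u} [Category.{v} C] [MonoidalCategory C]
    [RigidCategory C] (X : C) : PreservesColimitsOfSize.{0, 0} (tensorRight X) :=
  (tensorRightAdjunction X Xᘁ).leftAdjoint_preservesColimits

/-- A fusion category over `k`: a `k`-linear abelian rigid monoidal category, with bilinear tensor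
product, that has finite-dimensional morphism spaces, simple tensor unit and finitely many
isomorphism classes of simple objects, and in which every object is a finite direct sum of simple
objects. -/
class FusionCategory (k : Type w) [Field k] (C : Type u) [Category.{v} C] [Abelian C] [Linear k C]
    [MonoidalCategory C] [MonoidalPreadditive C] [MonoidalLinear k C] [RigidCategory C] :
    Prop where
  finite_hom : ∀ X Y : C, Module.Finite k (X ⟶ Y)
  simple_unit : Simple (𝟙_ C)
  finite_simples : ∃ (n : ℕ) (S : Fin n → C), (∀ i, Simple (S i)) ∧
    ∀ T : C, Simple T → ∃ i, Nonempty (T ≅ S i)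
  semisimple : ∀ X : C, ∃ (m : ℕ) (T : Fin m → C), (∀ i, Simple (T i)) ∧ Nonempty (X ≅ ⨁ T)

/-- A Frobenius algebra in a monoidal category whose multiplication is left inverse to its
comultiplication. -/
class SeparableFrobenius {C : Type u} [Category.{v} C] [MonoidalCategory C] (A : Mon C)
    extends ComonObj A.X where
  frobenius_left : A.X ◁ Δ[A.X] ≫ (α_ A.X A.X A.X).inv ≫ μ[A.X] ▷ A.X = μ[A.X] ≫ Δ[A.X]
  frobenius_right : Δ[A.X] ▷ A.X ≫ (α_ A.X A.X A.X).hom ≫ A.X ◁ μ[A.X] = μ[A.X] ≫ Δ[A.X]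
  comul_mul : Δ[A.X] ≫ μ[A.X] = 𝟙 A.X

variable {C : Type u} [Category.{v} C] [MonoidalCategory C]

/-- The algebra `A` as a right module over itself. -/
def RMod.reg (A : Mon C) : RMod A :=
  RMod.mk A.X μ[A.X] (MonObj.mul_one A.X) (by
    rw [MonObj.mul_assoc]; simp)

theorem SeparableFrobenius.unit_left (A : Mon C) [SeparableFrobenius A] :
    (ρ_ A.X).inv ≫ A.X ◁ η[A.X] ≫ A.X ◁ Δ[A.X] ≫ (α_ A.X A.X A.X).inv ≫ μ[A.X] ▷ A.X =
      Δ[A.X] := by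
  rw [SeparableFrobenius.frobenius_left, MonObj.mul_one_assoc, Iso.inv_hom_id_assoc]

theorem SeparableFrobenius.unit_right (A : Mon C) [SeparableFrobenius A] :
    (λ_ A.X).inv ≫ η[A.X] ▷ A.X ≫ Δ[A.X] ▷ A.X ≫ (α_ A.X A.X A.X).hom ≫ A.X ◁ μ[A.X] =
      Δ[A.X] := by
  rw [SeparableFrobenius.frobenius_right, MonObj.one_mul_assoc, Iso.inv_hom_id_assoc]

/-- Every right module over a separable Frobenius algebra is a retract of a free one. -/
theorem RMod.exists_retract {A : Mon C} [SeparableFrobenius A] (M : RMod A) :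
    ∃ (s : M ⟶ M.X ⊙ₗ RMod.reg A) (r : M.X ⊙ₗ RMod.reg A ⟶ M), s ≫ r = 𝟙 M := by
  let r : M.X ⊙ₗ RMod.reg A ⟶ M := RMod.homMk (M := M.X ⊙ₗ RMod.reg A) (show M.X ⊗ A.X ⟶ M.X from
    M.actRight) (by
      change ((α_ M.X A.X A.X).hom ≫ M.X ◁ μ[A.X]) ≫ M.actRight = M.actRight ▷ A.X ≫ M.actRight
      rw [Category.assoc, M.right_assoc]; simp)
  let s₀ : M.X ⟶ M.X ⊗ A.X := (ρ_ M.X).inv ≫ M.X ◁ (η[A.X] ≫ Δ[A.X]) ≫ (α_ M.X A.X A.X).inv ≫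
    M.actRight ▷ A.X
  have hs₀ : M.actRight ≫ s₀ = s₀ ▷ A.X ≫ (α_ M.X A.X A.X).hom ≫ M.X ◁ μ[A.X] := by
    have h1 : M.actRight ≫ s₀ = M.X ◁ Δ[A.X] ≫ (α_ M.X A.X A.X).inv ≫ M.actRight ▷ A.X := by
      have e := congrArg (fun t => M.X ◁ t) (SeparableFrobenius.unit_left A)
      have a := congrArg (fun t => t ▷ A.X) M.right_assoc
      simp only [MonoidalCategory.whiskerLeft_comp, comp_whiskerRight] at e a
      calc M.actRight ≫ s₀ = (ρ_ _).inv ≫ (M.X ⊗ A.X) ◁ (η[A.X] ≫ Δ[A.X]) ≫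
            (α_ (M.X ⊗ A.X) A.X A.X).inv ≫ (M.actRight ▷ A.X) ▷ A.X ≫ M.actRight ▷ A.X := by
              simp only [s₀]
              rw [rightUnitor_inv_naturality_assoc, ← whisker_exchange_assoc,
                associator_inv_naturality_left_assoc]
        _ = M.X ◁ (ρ_ _).inv ≫ M.X ◁ A.X ◁ η[A.X] ≫ M.X ◁ A.X ◁ Δ[A.X] ≫
            M.X ◁ (α_ A.X A.X A.X).inv ≫ M.X ◁ μ[A.X] ▷ A.X ≫ (α_ M.X A.X A.X).inv ≫
            M.actRight ▷ A.X := by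
              have h : (M.actRight ▷ A.X) ▷ A.X ≫ M.actRight ▷ A.X =
                (α_ M.X A.X A.X).hom ▷ A.X ≫ (M.X ◁ μ[A.X]) ▷ A.X ≫ M.actRight ▷ A.X := by
                rw [a]; simp
              rw [h]; monoidal
        _ = _ := by rw [← e]; monoidal
    have h2 : s₀ ▷ A.X ≫ (α_ M.X A.X A.X).hom ≫ M.X ◁ μ[A.X] =
        M.X ◁ Δ[A.X] ≫ (α_ M.X A.X A.X).inv ≫ M.actRight ▷ A.X := by
      have e := congrArg (fun t => M.X ◁ t) (SeparableFrobenius.unit_right A)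
      simp only [MonoidalCategory.whiskerLeft_comp, comp_whiskerRight] at e
      calc s₀ ▷ A.X ≫ (α_ M.X A.X A.X).hom ≫ M.X ◁ μ[A.X] =
          (ρ_ M.X).inv ▷ A.X ≫ (M.X ◁ (η[A.X] ≫ Δ[A.X])) ▷ A.X ≫ (α_ M.X A.X A.X).inv ▷ A.X ≫
            (α_ (M.X ⊗ A.X) A.X A.X).hom ≫ M.actRight ▷ (A.X ⊗ A.X) ≫ M.X ◁ μ[A.X] := by
              simp [s₀]
        _ = (ρ_ M.X).inv ▷ A.X ≫ (M.X ◁ (η[A.X] ≫ Δ[A.X])) ▷ A.X ≫ (α_ M.X A.X A.X).inv ▷ A.X ≫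
            (α_ (M.X ⊗ A.X) A.X A.X).hom ≫ (M.X ⊗ A.X) ◁ μ[A.X] ≫ M.actRight ▷ A.X := by
              rw [whisker_exchange]
        _ = _ := by rw [← e]; monoidal
    rw [h1, h2]
  let s : M ⟶ M.X ⊙ₗ RMod.reg A := RMod.homMk (N := M.X ⊙ₗ RMod.reg A) s₀ hs₀
  refine ⟨s, r, Bimod.hom_ext _ _ ?_⟩
  change s₀ ≫ M.actRight = 𝟙 M.X
  have h1 : η[A.X] ≫ Δ[A.X] ≫ μ[A.X] = η[A.X] := by
    rw [SeparableFrobenius.comul_mul, Category.comp_id]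
  simp only [s₀, Category.assoc]
  rw [← M.right_assoc, ← MonoidalCategory.whiskerLeft_comp_assoc, Category.assoc, h1,
    M.actRight_one]
  simp

end Fusion

section Defects

open scoped MonoidalLeftAction MonObj ComonObj
open MonoidalLeftAction

attribute [local instance] Abelian.hasFiniteBiproducts

theorem exists_generator (k : Type w) [Field k] {C : Type u} [Category.{v} C] [Abelian C]
    [Linear k C] [MonoidalCategory C] [MonoidalPreadditive C] [MonoidalLinear k C]
    [RigidCategory C] [FusionCategory k C] (A : Mon C) [SeparableFrobenius A] :
    ∃ P : RMod A, ∀ M : RMod A, ∃ (n : ℕ) (p : Fin n → (M ⟶ P)) (q : Fin n → (P ⟶ M)),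
      ∑ i, p i ≫ q i = 𝟙 M := by
  obtain ⟨n, S, -, hS⟩ := FusionCategory.finite_simples (k := k) (C := C)
  refine ⟨(⨁ S) ⊙ₗ RMod.reg A, fun M => ?_⟩
  obtain ⟨s, r, hsr⟩ := RMod.exists_retract M
  obtain ⟨m, T, hT, ⟨φ⟩⟩ := FusionCategory.semisimple (k := k) M.X
  choose σ hσ using fun i => hS (T i) (hT i)
  let ψ : ∀ i, T i ≅ S (σ i) := fun i => Classical.choice (hσ i)
  let x : Fin m → (M.X ⟶ ⨁ S) := fun i => φ.hom ≫ biproduct.π T i ≫ (ψ i).hom ≫ biproduct.ι S (σ i)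
  let y : Fin m → ((⨁ S) ⟶ M.X) := fun i =>
    biproduct.π S (σ i) ≫ (ψ i).inv ≫ biproduct.ι T i ≫ φ.inv
  have hxy : ∑ i, x i ≫ y i = 𝟙 M.X := by
    have h : ∀ i, x i ≫ y i = φ.hom ≫ (biproduct.π T i ≫ biproduct.ι T i) ≫ φ.inv := by
      intro i; simp [x, y]
    simp only [h]
    rw [← Preadditive.comp_sum, ← Preadditive.sum_comp, biproduct.total]
    simp
  refine ⟨m, fun i => s ≫ x i ⊵ₗ RMod.reg A, fun i => y i ⊵ₗ RMod.reg A ≫ r, ?_⟩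
  have h : ∀ i, (s ≫ x i ⊵ₗ RMod.reg A) ≫ y i ⊵ₗ RMod.reg A ≫ r =
      s ≫ ((x i ≫ y i) ⊵ₗ RMod.reg A) ≫ r := by
    intro i; simp
  simp only [h]
  rw [← Preadditive.comp_sum, ← Preadditive.sum_comp]
  have h2 : ∑ i, (x i ≫ y i) ⊵ₗ RMod.reg A = 𝟙 (M.X ⊙ₗ RMod.reg A) := by
    apply Bimod.hom_ext
    rw [RMod.sum_hom]
    change ∑ i, (x i ≫ y i) ▷ A.X = 𝟙 (M.X ⊗ A.X)
    rw [← sum_whiskerRight, hxy, id_whiskerRight]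
  rw [h2, Category.id_comp, hsr]

theorem nonempty_defectNat (k : Type w) [Field k] {C : Type u} [Category.{v} C] [Abelian C]
    [Linear k C] [MonoidalCategory C] [MonoidalPreadditive C] [MonoidalLinear k C]
    [RigidCategory C] [FusionCategory k C] {A B : Mon C} [SeparableFrobenius A] (X Y : Bimod A B) :
    Nonempty (InternalNat C (induct X) (induct Y)) := by
  obtain ⟨P, hP⟩ := exists_generator k A
  have hfin : Module.Finite k (P.X ⟶ P.X) := FusionCategory.finite_hom P.X P.X
  have hfin' : Module.Finite k (P ⟶ P) :=
    Module.Finite.of_injective (RMod.homLinear P P k) (RMod.hom_injective P P)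
  obtain ⟨r, b, hb⟩ := Module.Finite.exists_fin (R := k) (M := (P ⟶ P))
  obtain ⟨E, e, h1, h2⟩ := exists_end k (induct X) (induct Y) P b hb hP
  exact nonempty_internalNat h1 h2

variable (k : Type w) [Field k] {C : Type u} [Category.{v} C] [Abelian C] [Linear k C]
  [MonoidalCategory C] [MonoidalPreadditive C] [MonoidalLinear k C] [RigidCategory C]
  [FusionCategory k C]

/-- The internal natural transformations from `G^X = - ⊗_A X` to `G^Y = - ⊗_A Y`. -/
noncomputable def defectNat {A B : Mon C} [SeparableFrobenius A] (X Y : Bimod A B) :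
    InternalNat C (induct X) (induct Y) :=
  Classical.choice (nonempty_defectNat k X Y)

/-- The object `D^{X,Y}` of defect fields in the Drinfeld center, for bimodules `X` and `Y`. -/
noncomputable def defectField {A B : Mon C} [SeparableFrobenius A] (X Y : Bimod A B) : Center C :=
  (defectNat k X Y).obj

variable {A A' A'' : Mon C} [SeparableFrobenius A] [SeparableFrobenius A']
  (X₁ X₃ : Bimod A A') (X₂ X₄ : Bimod A' A'')

/-- `D^{X₁ ⊗ X₂, X₃ ⊗ X₄}` as internal natural transformations between composite functors. -/
noncomputable def defectNatComp :
    InternalNat C (induct X₁ ⋙ induct X₂) (induct X₃ ⋙ induct X₄) :=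
  (defectNat k (X₁.tensorBimod X₂) (X₃.tensorBimod X₄)).ofIso
    (inductComp X₁ X₂).symm (inductComp X₃ X₄).symm
    (IsModNat.inv (inductComp_isModNat X₁ X₂)) (IsModNat.inv (inductComp_isModNat X₃ X₄))

/-- The left horizontal operator product of defect fields. -/
noncomputable def muHorLeft :
    defectField k X₂ X₄ ⊗ defectField k X₁ X₃ ⟶
      defectField k (X₁.tensorBimod X₂) (X₃.tensorBimod X₄) :=
  horLeft (defectNat k X₂ X₄) (defectNat k X₁ X₃) (defectNatComp k X₁ X₃ X₂ X₄)

/-- The right horizontal operator product of defect fields. -/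
noncomputable def muHorRight :
    defectField k X₁ X₃ ⊗ defectField k X₂ X₄ ⟶
      defectField k (X₁.tensorBimod X₂) (X₃.tensorBimod X₄) :=
  horRight (defectNat k X₂ X₄) (defectNat k X₁ X₃) (defectNatComp k X₁ X₃ X₂ X₄)

end Defects

end DefectFields

namespace DefectFields

/-! ### The exchange law for horizontal products of internal natural transformations. -/

section HorizontalExchange

open scoped MonoidalLeftAction
open Functor.LaxLeftLinear MonoidalLeftAction

variable {C : Type u} [Category.{v} C] [MonoidalCategory C]
variable {M : Type u₁} [Category.{v₁} M] [MonoidalLeftAction C M]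
variable {N : Type u₂} [Category.{v₂} N] [MonoidalLeftAction C N]
variable {L : Type u₃} [Category.{v₃} L] [MonoidalLeftAction C L]
variable [HasInternalHoms C N] [HasInternalHoms C L]

/-! Internal natural transformations are handled through their evaluations. Write `E₂₄` and `E₁₃`
for the underlying objects of `I₂₄` and `I₁₃`, and `φ_n : E₂₄ ⊙ G₂ n ⟶ G₄ n` and `ψ_m : E₁₃ ⊙ G₁ m ⟶
G₃ m` for the morphisms obtained from the structure morphisms `j` by evaluating the internal Hom.
Dinaturality of `j` is ordinary naturality of these families (`isDinat_iff`), and `isMod` says that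
they are module transformations, where `E₂₄ ⊙ G₂` is a module functor by means of the half-braiding
of `E₂₄`.

Evaluated at `m`, and up to associators, the left product first moves `E₁₃` inside `G₂`, applies `G₂
ψ_m`, and then applies `φ` at `G₃ m`. The right product first applies `φ` at `G₁ m`, moves `E₁₃`
inside `G₄`, and then applies `G₄ ψ_m`. Two facts about `φ` turn one into the other. Naturality of
`φ` along the single morphism `ψ_m : E₁₃ ⊙ G₁ m ⟶ G₃ m` replaces `φ` at `G₃ m` after `G₂ ψ_m` by `G₄
ψ_m` after `φ` at `E₁₃ ⊙ G₁ m`. Compatibility of `φ` with the action of `E₁₃` on `G₁ m` then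
rewrites `φ` at `E₁₃ ⊙ G₁ m` as `φ` at `G₁ m`, at the price of moving `E₂₄` past `E₁₃`. That passage
is the half-braiding of `E₂₄`, and it is the whole discrepancy between the two products. In this
computation `E₁₃` plays the role of an arbitrary object of `C` that acts; its own half-braiding
matters only for the two products to be morphisms in the center.

The computation is `horLeftFam_eq_halfBraiding_comp`, resting on the evaluation formulas
`horLeftFam_ev` and `horRightFam_ev`. It passes from families to products by the universal property
of the end: `InternalNat.lift_j` computes the components of an induced morphism, and
`InternalNat.hom_ext` says that components determine a morphism. This gives
`horLeft_eq_braiding_comp_horRight` for arbitrary module functors.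

The algebra enters through the construction of the objects to which this law is applied. Over a
separable Frobenius algebra every module is a retract of a free one, so with finite semisimplicity
one module generates all others; the end is then an equalizer between finite products
(`exists_end`), and rigidity provides its half-braiding (`halfBraiding_of_rep`). Finally,
`inductComp_isModNat` makes the associativity of the relative tensor product an isomorphism of
module functors, which identifies transformations of composites with defect fields for the tensor
products of bimodules. -/

/-- A morphism in the center into an object of internal natural transformations is determined by
its composites with the structure morphisms of the end. -/
theorem InternalNat.hom_ext {F F' : M ⥤ N} [F.LeftLinear C] [F'.LeftLinear C]
    (I : InternalNat C F F') {Z : Center C} {f g : Z ⟶ I.obj}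
    (h : ∀ m, f.f ≫ I.j m = g.f ≫ I.j m) : f = g := by
  -- The end is universal in `C`, not in the center. This suffices because a morphism in the center
  -- is determined by its underlying morphism: both `f.f` and `g.f` factor the family `g.f ≫ I.j m`,
  -- and such a factorization is unique.
  refine Center.ext _ _ ((I.exists_unique Z.1 (fun m => g.f ≫ I.j m) ?_).unique h fun _ => rfl)
  -- What remains is the dinaturality of `g.f ≫ I.j m`, which precomposition preserves.
  intro m m' k
  simp only [Category.assoc, I.dinat k]

/-- The underlying morphism of `lift` is the factorization chosen from the universal property in
`C`, so its defining equations hold by choice. Compatibility with half-braidings is extra data and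
does not affect them. -/
theorem InternalNat.lift_j [RigidCategory C] {F F' : M ⥤ N} [F.LeftLinear C] [F'.LeftLinear C]
    (I : InternalNat C F F') (Z : Center C)
    (φ : ∀ m, Z.1 ⟶ iHom C (F.obj m) (F'.obj m)) (hd : IsDinat Z.1 F F' φ)
    (hm : IsModFam Z F F' (fun m => φ m ⊵ₗ F.obj m ≫ iEv C _ _)) (m : M) :
    (I.lift Z φ hd hm).f ≫ I.j m = φ m :=
  (I.exists_unique Z.1 φ hd).choose_spec.1 m

/-! ### Comparison of the left and right products for general module functors. -/

variable {G₁ G₃ : M ⥤ N} {G₂ G₄ : N ⥤ L} [G₁.LeftLinear C] [G₂.LeftLinear C]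
  [G₃.LeftLinear C] [G₄.LeftLinear C]
variable (I₂₄ : InternalNat C G₂ G₄) (I₁₃ : InternalNat C G₁ G₃)

/-- The families that define the two horizontal products differ by a half-braiding. -/
theorem horLeftFam_eq_halfBraiding_comp (m : M) :
    horLeftFam I₂₄ I₁₃ m = (I₂₄.obj.2.β I₁₃.obj.1).hom ≫ horRightFam I₂₄ I₁₃ m := by
  -- Morphisms into an internal Hom agree once they agree after evaluation. This moves the problem
  -- from `C` to `L`, where the module functor structures can be used.
  apply iHom_ext
  -- Naturality of the evaluation of `I₂₄`, taken along the evaluation of `I₁₃` at `m`. The latter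
  -- is a morphism of `N`, with source `I₁₃.obj.1 ⊙ₗ G₁.obj m`.
  have h₁ := (isDinat_iff _).1 I₂₄.dinat (I₁₃.j m ⊵ₗ G₁.obj m ≫ iEv C _ _)
  -- The module condition on `I₂₄`, with the other defect object as the acting object. It concerns
  -- exactly the source of the morphism used in `h₁`, and it is where the half-braiding appears.
  have h₂ := I₂₄.isMod I₁₃.obj.1 (G₁.obj m)
  simp only [Category.assoc] at h₁ h₂
  rw [comp_actionHomLeft, Category.assoc]
  -- Both sides are replaced by their evaluated forms. These are stated with `G₂.obj (G₁.obj m)`,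
  -- which agrees by definition with the value of `G₁ ⋙ G₂` at `m`.
  refine (horLeftFam_ev I₂₄ I₁₃ m).trans
    (Eq.trans ?_ (congrArg (fun t => _ ≫ t) (horRightFam_ev I₂₄ I₁₃ m)).symm)
  -- `h₁` carries the evaluation of `I₁₃` across to `G₄`, and `h₂` then produces the half-braiding.
  -- The inverse associator at the front of `h₂` cancels the associator with which the evaluated
  -- left family begins.
  rw [actionHomRight_comp, Category.assoc, h₁, reassoc_of% h₂, Iso.hom_inv_id_assoc,
    actionHomRight_comp, Category.assoc]
  simp only [Functor.comp_obj]

/-- This and its right-hand analogue hold for any choice of `I`, so the comparison below does not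
depend on how the end over the composite functors was built. -/
theorem horLeft_j [RigidCategory C] (I : InternalNat C (G₁ ⋙ G₂) (G₃ ⋙ G₄)) (m : M) :
    (horLeft I₂₄ I₁₃ I).f ≫ I.j m = horLeftFam I₂₄ I₁₃ m :=
  I.lift_j _ _ (horLeftFam_dinat I₂₄ I₁₃) (horLeftFam_isMod I₂₄ I₁₃) m

theorem horRight_j [RigidCategory C] (I : InternalNat C (G₁ ⋙ G₂) (G₃ ⋙ G₄)) (m : M) :
    (horRight I₂₄ I₁₃ I).f ≫ I.j m = horRightFam I₂₄ I₁₃ m :=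
  I.lift_j _ _ (horRightFam_dinat I₂₄ I₁₃) (horRightFam_isMod I₂₄ I₁₃) m

/-- The left and right horizontal products of internal natural transformations differ by a
half-braiding. -/
theorem horLeft_eq_braiding_comp_horRight [RigidCategory C]
    (I : InternalNat C (G₁ ⋙ G₂) (G₃ ⋙ G₄)) :
    horLeft I₂₄ I₁₃ I = (β_ I₂₄.obj I₁₃.obj).hom ≫ horRight I₂₄ I₁₃ I := by
  -- The equation in the center becomes a family of equations in `C`, one for each `m`.
  apply I.hom_ext
  intro m
  rw [Center.comp_f, Category.assoc]
  -- The underlying morphism of the braiding in the center is by definition the half-braiding of the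
  -- first factor at the object underlying the second. Hence the comparison of families applies to
  -- it directly.
  exact (horLeft_j I₂₄ I₁₃ I m).trans ((horLeftFam_eq_halfBraiding_comp I₂₄ I₁₃ m).trans
    (congrArg (fun t => (I₂₄.obj.2.β I₁₃.obj.1).hom ≫ t) (horRight_j I₂₄ I₁₃ I m).symm))

end HorizontalExchange

end DefectFields

/-! ### The exchange law for defect fields. -/

theorem mainTheorem5 {k : Type*} [Field k] [IsAlgClosed k] [CharZero k]
    {C : Type*} [Category* C] [Abelian C] [Linear k C] [MonoidalCategory C]
    [MonoidalPreadditive C] [MonoidalLinear k C] [RigidCategory C]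
    [DefectFields.FusionCategory k C]
    {A A' A'' : Mon C} [DefectFields.SeparableFrobenius A] [DefectFields.SeparableFrobenius A']
    [DefectFields.SeparableFrobenius A'']
    (X₁ X₃ : Bimod A A') (X₂ X₄ : Bimod A' A'') :
    DefectFields.muHorLeft k X₁ X₃ X₂ X₄ =
      (β_ (DefectFields.defectField k X₂ X₄) (DefectFields.defectField k X₁ X₃)).hom ≫
        DefectFields.muHorRight k X₁ X₃ X₂ X₄ :=
  -- The general law is applied to the functors `induct Xᵢ`. The end over the composites is
  -- `defectNatComp`, whose object in the center is literally that of the defect fields for the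
  -- tensor product bimodules: transport by `ofIso` changes only the structure morphisms. So source
  -- and target match without a further comparison isomorphism. As `≫` composes in diagrammatic
  -- order, the half-braiding of `defectField k X₂ X₄` acts before the right product.
  DefectFields.horLeft_eq_braiding_comp_horRight (DefectFields.defectNat k X₂ X₄)
    (DefectFields.defectNat k X₁ X₃) (DefectFields.defectNatComp k X₁ X₃ X₂ X₄)
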